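/- Let $K:(0,\infty)\to\mathbb{R}$ belong to $L^2_{loc}(\mathbb{R}_+,\mathbb{R})$, where $\mathbb{R}_+=[0,\infty)$. Assume that $K$ is strictly positive and completely monotone on $(0,\infty)$ (that is, $K$ is infinitely differentiable on $(0,\infty)$ and $(-1)^kK^{(k)}(t)\ge 0$ for all $t>0$ and $k=0,1,\dots$), and that there is $\gamma\in(0,2]$ such that, as $h\downarrow 0$, $\int_0^hK(t)^2\,dt=O(h^\gamma)$ and $\int_0^T(K(t+h)-K(t))^2\,dt=O(h^\gamma)$ for every $0<T<\infty$. Let $\kappa>0$, $\sigma>0$, $\theta\neq 0$ and $\rho\in[-1,1]$ be constants and put $\lambda=\kappa+2\theta\rho\sigma$. Consider the Riccati–Volterra equation $$\psi(t)=\int_0^tK(t-s)\Big[\frac{(1-2\rho^2)\sigma^2}{2}\psi^2(s)-\lambda\psi(s)-\theta^2\Big]ds.\qquad(\ast)$$ 1. If $1-2\rho^2>0$, then $(\ast)$ has a global continuous solution $\psi\in L^2_{loc}(\mathbb{R}_+,\mathbb{R})$ on $[0,\infty)$. It is the only global continuous solution and, up to equality almost everywhere, the only global solution in $L^2_{loc}(\mathbb{R}_+,\mathbb{R})$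 (where the equation is required for almost every $t\ge0$). Moreover $\psi(t)<0$ for all $t>0$. 2. If $1-2\rho^2=0$, then $(\ast)$ is linear, i.e. the bracket is $-\lambda\psi(s)-\theta^2$, and for every $T>0$ it has a unique continuous solution on $[0,T]$. 3. If $1-2\rho^2<0$, $\lambda>0$ and $\lambda^2+2(1-2\rho^2)\theta^2\sigma^2>0$, put $$\bar w_*=\frac{\lambda-\sqrt{\lambda^2+2(1-2\rho^2)\theta^2\sigma^2}}{\sigma^2},\qquad \bar Q_2(w)=\int_0^w\frac{du}{\frac{\sigma^2}{2}u^2-\lambda u-(1-2\rho^2)\theta^2}.$$ Then $\bar Q_2$ maps $[0,\bar w_*)$ bijectively onto $[0,\infty)$, so that $\bar r_2(t)=\bar Q_2^{-1}\big(\int_0^tK(s)\,ds\big)\in[0,\bar w_*)$ is well defined for $t\geq 0$. Equation $(\ast)$ has a unique global continuous solution $\psi$ on $[0,\infty)$, and $$\frac{\bar w_*}{1-2\rho^2}<\frac{\bar r_2(t)}{1-2\rho^2}\le\psi(t)<0\qquad\text{for all }t>0.$$ -/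

import Mathlib

open Set MeasureTheory Filter Asymptotics
open scoped Topology ContDiff

noncomputable section

namespace VolterraHeston

/-- `f` belongs to `L²_loc(ℝ₊, ℝ)`, with `ℝ₊ = [0, ∞)`. -/
def LocallySquareIntegrable (f : ℝ → ℝ) : Prop :=
  ∀ T : ℝ, 0 < T → MemLp f 2 (volume.restrict (Icc 0 T))

/-- `f` is completely monotone on `(0, ∞)`. -/
def CompletelyMonotone (f : ℝ → ℝ) : Prop :=
  ContDiffOn ℝ ∞ f (Ioi 0) ∧ ∀ (k : ℕ) (t : ℝ), 0 < t → 0 ≤ (-1 : ℝ) ^ k * iteratedDeriv k f t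

/-- The standing assumption on the kernel `K`. The values of `K` on `(-∞, 0]` play no role. -/
structure KernelAssumption (K : ℝ → ℝ) : Prop where
  locallySquareIntegrable : LocallySquareIntegrable K
  pos : ∀ t : ℝ, 0 < t → 0 < K t
  completelyMonotone : CompletelyMonotone K
  regularity : ∃ γ : ℝ, 0 < γ ∧ γ ≤ 2 ∧
    (fun h : ℝ => ∫ t in (0 : ℝ)..h, K t ^ 2) =O[𝓝[>] 0] (fun h : ℝ => h ^ γ) ∧
    ∀ T : ℝ, 0 < T →
      (fun h : ℝ => ∫ t in (0 : ℝ)..T, (K (t + h) - K t) ^ 2) =O[𝓝[>] 0] (fun h : ℝ => h ^ γ)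

/-- `λ = κ + 2 θ ρ σ`. -/
def lam (κ σ θ ρ : ℝ) : ℝ := κ + 2 * θ * ρ * σ

/-- The quadratic nonlinearity `(1 - 2ρ²) σ² / 2 · w² - λ w - θ²`. -/
def riccatiRhs (κ σ θ ρ w : ℝ) : ℝ :=
  (1 - 2 * ρ ^ 2) * σ ^ 2 / 2 * w ^ 2 - lam κ σ θ ρ * w - θ ^ 2

/-- At time `t`, the function `ψ` satisfies `ψ(t) = ∫₀ᵗ K(t - s) G(ψ(s)) ds`, where the integral
exists. -/
def VolterraEqAt (K G ψ : ℝ → ℝ) (t : ℝ) : Prop :=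
  IntervalIntegrable (fun s => K (t - s) * G (ψ s)) volume 0 t ∧
    ψ t = ∫ s in (0 : ℝ)..t, K (t - s) * G (ψ s)

/-- `ψ` is a continuous solution, on the time interval `I`, of `ψ = K * G(ψ)`. The interval is
either `[0, T]` or `[0, ∞)` (a global solution). -/
def IsContinuousSolution (K G : ℝ → ℝ) (I : Set ℝ) (ψ : ℝ → ℝ) : Prop :=
  ContinuousOn ψ I ∧ ∀ t ∈ I, VolterraEqAt K G ψ t

/-- `ψ` is a global solution of `ψ = K * G(ψ)` of class `L²_loc(ℝ₊, ℝ)`; as `ψ` is then only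
determined up to null sets, the equation is required almost everywhere. -/
def IsLocallySquareIntegrableSolution (K G : ℝ → ℝ) (ψ : ℝ → ℝ) : Prop :=
  LocallySquareIntegrable ψ ∧ ∀ᵐ t ∂(volume.restrict (Ici (0 : ℝ))), VolterraEqAt K G ψ t

/-- `w̄_* = (λ - √(λ² + 2 (1 - 2ρ²) θ² σ²)) / σ²`. -/
def wBar (κ σ θ ρ : ℝ) : ℝ :=
  (lam κ σ θ ρ - √(lam κ σ θ ρ ^ 2 + 2 * (1 - 2 * ρ ^ 2) * θ ^ 2 * σ ^ 2)) / σ ^ 2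

/-- `Q̄₂(w) = ∫₀ʷ du / (σ²/2 · u² - λ u - (1 - 2ρ²) θ²)`. -/
def QBar (κ σ θ ρ w : ℝ) : ℝ :=
  ∫ u in (0 : ℝ)..w, 1 / (σ ^ 2 / 2 * u ^ 2 - lam κ σ θ ρ * u - (1 - 2 * ρ ^ 2) * θ ^ 2)

/-- `r̄₂(t) = Q̄₂⁻¹(∫₀ᵗ K(s) ds)`, with the inverse taken of `Q̄₂` on `[0, w̄_*)`. -/
def rBar (K : ℝ → ℝ) (κ σ θ ρ t : ℝ) : ℝ :=
  Function.invFunOn (QBar κ σ θ ρ) (Ico 0 (wBar κ σ θ ρ)) (∫ s in (0 : ℝ)..t, K s)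

end VolterraHeston

end

/-! Multiplication by a constant turns the nonlinear cases into v = K * H(v) with v ≥ 0: v = -ψ when
1 - 2ρ² > 0, and v = (1 - 2ρ²)ψ when 1 - 2ρ² < 0. In both, H is positive on [0, b) and vanishes at a
root b. Composing H with the projection onto [0, b] makes it globally Lipschitz, and a contraction
in an exponentially weighted sup norm gives a global solution (`exists_solution`), which also
settles the linear case. Since K is positive and nonincreasing, this solution stays in [0, b]: above
b the forcing stops and the effect of past forcing only fades (`le_of_forcing_vanishes_above`).
Hence it solves the original equation.

Uniqueness of continuous solutions is a Gronwall inequality with the same weights. For L² solutions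
the Lipschitz modulus of the quadratic is itself only L². Cauchy–Schwarz then gives an L¹ Gronwall
inequality for the squared difference, with kernel a multiple of K².

The bound by r̄₂ comes from v' ≤ K H(v), which integrates to Q̄₂(v(t)) ≤ ∫₀ᵗ K. For a smooth kernel
k, v' = k(0) H(v) + k' * H(v). If v increases and H decreases, then k' ≤ 0 bounds this by k(t)
H(v(t)). Monotonicity of v is where complete monotonicity enters: it makes the kernel log-convex
(`sq_le_mul_of_alternating`), and Kaluza's comparison then keeps v' positive (`vconvDeriv_pos`). As
K may be singular at 0, this is carried out for the shifts K(· + ε), and stability under ε → 0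
transfers the bound (`le_of_integral_inv_eq`). -/

namespace VolterraHeston

/-! ### Log-convexity of completely monotone functions -/

section LogConvexity

variable {c : ℕ → ℝ → ℝ}

theorem antitoneOn_of_hasDerivAt_nonpos {f f' : ℝ → ℝ}
    (hd : ∀ t, 0 < t → HasDerivAt f (f' t) t) (h0 : ∀ t, 0 < t → f' t ≤ 0) :
    AntitoneOn f (Ioi 0) := by
  refine antitoneOn_of_hasDerivWithinAt_nonpos (f' := f') (convex_Ioi 0)
    (fun t ht => (hd t ht).continuousAt.continuousWithinAt) ?_ ?_
  · intro x hx
    rw [interior_Ioi] at hx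
    exact (hd x hx).hasDerivWithinAt
  · intro x hx
    rw [interior_Ioi] at hx
    exact h0 x hx

/-- By the mean value theorem, c j drops over [t, s] by at least (s - t) times the smallest value of
c (j + 1) there, which is the one at s. The use is that c (j + 1) tends to 0 at infinity. -/
theorem mul_sub_le_of_alternating
    (hd : ∀ j t, 0 < t → HasDerivAt (c j) (-(c (j + 1) t)) t)
    (h0 : ∀ j t, 0 < t → 0 ≤ c j t) (j : ℕ) {t s : ℝ} (ht : 0 < t) (hts : t < s) :
    c (j + 1) s * (s - t) ≤ c j t := by
  have hanti : AntitoneOn (c (j + 1)) (Ioi 0) :=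
    antitoneOn_of_hasDerivAt_nonpos (hd (j + 1)) fun t ht => by simpa using h0 (j + 2) t ht
  obtain ⟨x, hx, hxe⟩ := exists_hasDerivAt_eq_slope (c j) (fun t => -(c (j + 1) t)) hts
    (fun x hx => (hd j x (ht.trans_le hx.1)).continuousAt.continuousWithinAt)
    (fun x hx => hd j x (ht.trans hx.1))
  have h1 := hanti (ht.trans hx.1) (ht.trans hts) hx.2.le
  have h2 : 0 < s - t := sub_pos.2 hts
  rw [eq_div_iff h2.ne'] at hxe
  have h3 := h0 j s (ht.trans hts)
  nlinarith [mul_le_mul_of_nonneg_right h1 h2.le]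

/-- The hypothesis says exactly that C c_j c_{j+2} - c_{j+1}² has nonpositive derivative. This
function is then nonincreasing, and its lower limit at infinity is nonnegative because c_{j+1}
decays. -/
theorem sq_le_mul_of_deriv_nonpos
    (hd : ∀ j t, 0 < t → HasDerivAt (c j) (-(c (j + 1) t)) t)
    (h0 : ∀ j t, 0 < t → 0 ≤ c j t) (j : ℕ) {C : ℝ} (hC : 0 ≤ C)
    (h : ∀ t, 0 < t → (2 - C) * (c (j + 1) t * c (j + 2) t) ≤ C * (c j t * c (j + 3) t))
    {t : ℝ} (ht : 0 < t) : c (j + 1) t ^ 2 ≤ C * (c j t * c (j + 2) t) := by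
  have hφ : AntitoneOn (fun t => C * (c j t * c (j + 2) t) - c (j + 1) t ^ 2) (Ioi 0) := by
    refine antitoneOn_of_hasDerivAt_nonpos (fun t ht =>
      (((hd j t ht).mul (hd (j + 2) t ht)).const_mul C).sub ((hd (j + 1) t ht).pow 2)) ?_
    intro t ht
    have := h t ht
    push_cast
    ring_nf at this ⊢
    linarith
  have hlim : Tendsto (fun s : ℝ => -(c j t / (s - t)) ^ 2) atTop (𝓝 (-0 ^ 2)) := by
    refine (Tendsto.pow ?_ 2).neg
    exact tendsto_const_nhds.div_atTop (tendsto_atTop_add_const_right _ _ tendsto_id)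
  have hle : -0 ^ 2 ≤ C * (c j t * c (j + 2) t) - c (j + 1) t ^ 2 := by
    refine le_of_tendsto hlim ?_
    filter_upwards [eventually_gt_atTop t] with s hs
    have hs0 : 0 < s := ht.trans hs
    have h1 := hφ (mem_Ioi.2 ht) (mem_Ioi.2 hs0) hs.le
    have h2 : c (j + 1) s ≤ c j t / (s - t) := by
      rw [le_div_iff₀ (sub_pos.2 hs)]
      exact mul_sub_le_of_alternating hd h0 j ht hs
    have h3 : c (j + 1) s ^ 2 ≤ (c j t / (s - t)) ^ 2 :=
      pow_le_pow_left₀ (h0 _ _ hs0) h2 2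
    have h4 : 0 ≤ C * (c j s * c (j + 2) s) :=
      mul_nonneg hC (mul_nonneg (h0 _ _ hs0) (h0 _ _ hs0))
    simp only at h1
    linarith
  linarith

/-- A sequence of nonnegative functions with `c j' = - c (j + 1)` is log-convex in the index. -/
theorem sq_le_mul_of_alternating
    (hd : ∀ j t, 0 < t → HasDerivAt (c j) (-(c (j + 1) t)) t)
    (h0 : ∀ j t, 0 < t → 0 ≤ c j t) (j : ℕ) {t : ℝ} (ht : 0 < t) :
    c (j + 1) t ^ 2 ≤ c j t * c (j + 2) t := by
  -- Constants valid for all j and t at once. The constant 2 is free, since the coefficient 2 - C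
  -- vanishes; a self-improvement then brings the infimum down to 1.
  let S : Set ℝ := {C | 1 ≤ C ∧ ∀ j t, 0 < t → c (j + 1) t ^ 2 ≤ C * (c j t * c (j + 2) t)}
  have h2S : (2 : ℝ) ∈ S := by
    refine ⟨by norm_num, fun j t ht => sq_le_mul_of_deriv_nonpos hd h0 j (by norm_num) ?_ ht⟩
    intro t ht
    have := mul_nonneg (h0 j t ht) (h0 (j + 3) t ht)
    linarith
  have hbdd : BddBelow S := ⟨1, fun C hC => hC.1⟩
  have hclosed : IsClosed S := by
    have : S = Ici 1 ∩ ⋂ (j : ℕ) (t : ℝ) (_ : 0 < t),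
        {C | c (j + 1) t ^ 2 ≤ C * (c j t * c (j + 2) t)} := by
      ext C; simp [S]
    rw [this]
    refine isClosed_Ici.inter (isClosed_iInter fun j => isClosed_iInter fun t =>
      isClosed_iInter fun _ => isClosed_le continuous_const (by fun_prop))
  have hinf : sInf S ∈ S := hclosed.csInf_mem ⟨2, h2S⟩ hbdd
  -- Multiplying the inequalities at j and j + 1 and cancelling gives c_{j+1} c_{j+2} ≤ C² c_j
  -- c_{j+3}. The new constant C' solves C' = (2 - C') C², which is what the derivative criterion
  -- needs.
  have hstep : ∀ C ∈ S, 2 * C ^ 2 / (1 + C ^ 2) ∈ S := by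
    rintro C ⟨hC1, hC⟩
    have hpos : 0 < 1 + C ^ 2 := by positivity
    refine ⟨by rw [le_div_iff₀ hpos]; nlinarith, fun j t ht =>
      sq_le_mul_of_deriv_nonpos hd h0 j (by positivity) ?_ ht⟩
    intro t ht
    have e1 : 2 - 2 * C ^ 2 / (1 + C ^ 2) = 2 / (1 + C ^ 2) := by field_simp; ring
    rw [e1, div_mul_eq_mul_div, div_mul_eq_mul_div, div_le_div_iff_of_pos_right hpos]
    have a0 := h0 j t ht
    have a1 := h0 (j + 1) t ht
    have a2 := h0 (j + 2) t ht
    have a3 := h0 (j + 3) t ht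
    have i1 := hC j t ht
    have i2 := hC (j + 1) t ht
    simp only [add_assoc] at i2
    norm_num at i2
    have key : c (j + 1) t * c (j + 2) t ≤ C ^ 2 * (c j t * c (j + 3) t) := by
      rcases (mul_nonneg a1 a2).eq_or_lt with h | h
      · rw [← h]; positivity
      · have := mul_le_mul i1 i2 (sq_nonneg _) (by positivity)
        refine le_of_mul_le_mul_right ?_ h
        calc _ = c (j + 1) t ^ 2 * c (j + 2) t ^ 2 := by ring
          _ ≤ _ := this
          _ = _ := by ring
    linarith
  -- The infimum m satisfies m ≤ 2m²/(1 + m²), that is (m - 1)² ≤ 0.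
  have hle := csInf_le hbdd (hstep _ hinf)
  have hone : sInf S = 1 := by
    have hpos : 0 < 1 + (sInf S) ^ 2 := by positivity
    rw [le_div_iff₀ hpos] at hle
    have h1 : 1 ≤ sInf S := hinf.1
    have h2 : 1 + sInf S ^ 2 ≤ 2 * sInf S :=
      le_of_mul_le_mul_left (by linarith) (zero_lt_one.trans_le h1)
    nlinarith
  have := hinf.2 j t ht
  rwa [hone, one_mul] at this

end LogConvexity

theorem CompletelyMonotone.hasDerivAt_iteratedDeriv {f : ℝ → ℝ} (hf : CompletelyMonotone f)
    (n : ℕ) {t : ℝ} (ht : 0 < t) :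
    HasDerivAt (iteratedDeriv n f) (iteratedDeriv (n + 1) f t) t := by
  have h1 := hf.1.differentiableOn_iteratedDerivWithin (m := n)
    (by exact_mod_cast WithTop.coe_lt_top n) (uniqueDiffOn_Ioi 0)
  have h2 : DifferentiableOn ℝ (iteratedDeriv n f) (Ioi 0) :=
    h1.congr fun x hx => (iteratedDerivWithin_of_isOpen isOpen_Ioi hx).symm
  rw [iteratedDeriv_succ]
  exact (h2.differentiableAt (Ioi_mem_nhds ht)).hasDerivAt

theorem CompletelyMonotone.hasDerivAt_alternating {f : ℝ → ℝ} (hf : CompletelyMonotone f)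
    (n : ℕ) {t : ℝ} (ht : 0 < t) :
    HasDerivAt (fun t => (-1 : ℝ) ^ n * iteratedDeriv n f t)
      (-((-1 : ℝ) ^ (n + 1) * iteratedDeriv (n + 1) f t)) t := by
  have := (hf.hasDerivAt_iteratedDeriv n ht).const_mul ((-1 : ℝ) ^ n)
  rw [pow_succ]
  simpa using this

/-- A completely monotone function is log-convex: `f'² ≤ f f''`. -/
theorem CompletelyMonotone.sq_deriv_le {f : ℝ → ℝ} (hf : CompletelyMonotone f)
    {t : ℝ} (ht : 0 < t) :
    iteratedDeriv 1 f t ^ 2 ≤ f t * iteratedDeriv 2 f t := by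
  have := sq_le_mul_of_alternating (c := fun n t => (-1 : ℝ) ^ n * iteratedDeriv n f t)
    (fun n t ht => hf.hasDerivAt_alternating n ht) (fun n t ht => hf.2 n t ht) 0 ht
  simpa using this

/-! ### Volterra convolutions -/

/-- The Volterra convolution `t ↦ ∫₀ᵗ a(t - s) b(s) ds`. -/
noncomputable def vconv (a b : ℝ → ℝ) (t : ℝ) : ℝ :=
  ∫ s in (0 : ℝ)..t, a (t - s) * b s

section Vconv

variable {a b : ℝ → ℝ} {t T : ℝ}

@[simp]
theorem vconv_zero_right_endpoint : vconv a b 0 = 0 := by simp [vconv]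

theorem vconv_comm : vconv a b t = vconv b a t := by
  have := intervalIntegral.integral_comp_sub_left (a := 0) (b := t)
    (fun s => a (t - s) * b s) t
  simp only [sub_sub_cancel, sub_self, sub_zero] at this
  rw [vconv, ← this, vconv]
  exact intervalIntegral.integral_congr fun s _ => mul_comm _ _

theorem intervalIntegrable_comp_sub (ht : 0 ≤ t) (ha : IntegrableOn a (Ioc 0 t)) :
    IntervalIntegrable (fun s => a (t - s)) volume 0 t := by
  have := ((intervalIntegrable_iff_integrableOn_Ioc_of_le ht).2 ha).comp_sub_left t
  simpa using this.symm

theorem intervalIntegrable_vconv (ht : 0 ≤ t) (ha : IntegrableOn a (Ioc 0 t))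
    (hb : ContinuousOn b (Icc 0 t)) :
    IntervalIntegrable (fun s => a (t - s) * b s) volume 0 t :=
  (intervalIntegrable_comp_sub ht ha).mul_continuousOn (by rwa [uIcc_of_le ht])

theorem vconv_eq_setIntegral_Ioo (ht : 0 ≤ t) :
    vconv a b t = ∫ s in Ioo 0 t, a (t - s) * b s := by
  rw [vconv, intervalIntegral.integral_of_le ht, integral_Ioc_eq_integral_Ioo]

theorem vconv_congr_Ioo {a' b' : ℝ → ℝ} (ht : 0 ≤ t) (ha : EqOn a a' (Ioo 0 t))
    (hb : EqOn b b' (Ioo 0 t)) : vconv a b t = vconv a' b' t := by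
  rw [vconv_eq_setIntegral_Ioo ht, vconv_eq_setIntegral_Ioo ht]
  refine setIntegral_congr_fun measurableSet_Ioo fun s hs => ?_
  rw [ha ⟨by linarith [hs.2], by linarith [hs.1]⟩, hb hs]

/-- With t moved from the limits of integration into an indicator, dominated convergence applies. At
a given t₀ the integrand can jump only for s = t₀, a null set. -/
theorem continuous_integral_indicator_comp_sub (ha : IntegrableOn a (Ioi 0)) (hb : Continuous b)
    {C : ℝ} (hC : ∀ x, |b x| ≤ C) :
    Continuous fun t => ∫ s in Ioi 0, a s * (Iio t).indicator (fun s => b (t - s)) s := by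
  have hmeas : ∀ t, Measurable ((Iio t).indicator fun s => b (t - s)) := fun t =>
    (hb.measurable.comp (measurable_const.sub measurable_id)).indicator measurableSet_Iio
  refine continuous_iff_continuousAt.2 fun t₀ =>
    continuousAt_of_dominated (bound := fun s => |a s| * C) ?_ ?_ (ha.abs.mul_const C) ?_
  · exact Eventually.of_forall fun t => ha.1.mul (hmeas t).aestronglyMeasurable
  · refine Eventually.of_forall fun t => ae_of_all _ fun s => ?_
    rw [norm_mul, Real.norm_eq_abs, Real.norm_eq_abs]
    refine mul_le_mul_of_nonneg_left ?_ (abs_nonneg _)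
    by_cases hs : s ∈ Iio t
    · simpa [indicator_of_mem hs] using hC _
    · simpa [indicator_of_notMem hs] using (abs_nonneg _).trans (hC 0)
  · have hne : ∀ᵐ s ∂(volume.restrict (Ioi (0 : ℝ))), s ≠ t₀ :=
      ae_restrict_of_ae (Measure.ae_ne volume t₀)
    filter_upwards [hne] with s hs
    rcases lt_or_gt_of_ne hs with h | h
    · have : (fun t => a s * (Iio t).indicator (fun s => b (t - s)) s)
          =ᶠ[𝓝 t₀] fun t => a s * b (t - s) := by
        filter_upwards [Ioi_mem_nhds h] with t ht
        rw [indicator_of_mem (mem_Iio.2 ht)]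
      exact (show Continuous fun t => a s * b (t - s) by fun_prop).continuousAt.congr this.symm
    · have : (fun t => a s * (Iio t).indicator (fun s => b (t - s)) s) =ᶠ[𝓝 t₀] fun _ => 0 := by
        filter_upwards [Iio_mem_nhds h] with t ht
        rw [indicator_of_notMem (by simpa using le_of_lt ht), mul_zero]
      exact continuousAt_const.congr this.symm

theorem integral_indicator_comp_sub_eq_vconv (ht : 0 ≤ t) :
    ∫ s in Ioi 0, a s * (Iio t).indicator (fun s => b (t - s)) s = vconv a b t := by
  rw [vconv_comm, vconv_eq_setIntegral_Ioo ht, ← Ioi_inter_Iio,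
    ← setIntegral_indicator measurableSet_Iio]
  refine integral_congr_ae (ae_of_all _ fun s => ?_)
  by_cases hs : s ∈ Iio t
  · simp [indicator_of_mem hs, mul_comm]
  · simp [indicator_of_notMem hs]

theorem continuousOn_vconv_Icc (hT : 0 ≤ T) (ha : IntegrableOn a (Ioc 0 T))
    (hb : ContinuousOn b (Icc 0 T)) : ContinuousOn (vconv a b) (Icc 0 T) := by
  obtain ⟨C, hC⟩ := isCompact_Icc.exists_bound_of_continuousOn hb
  -- Values outside [0, T] do not enter the convolution on [0, T], so a is cut off and b is extended
  -- by constants to be integrable and bounded on the whole line.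
  have hcont := continuous_integral_indicator_comp_sub
    (a := (Ioc 0 T).indicator a) (b := IccExtend hT ((Icc 0 T).domRestrict b)) (C := C)
    ((integrable_indicator_iff measurableSet_Ioc).2 ha).integrableOn
    (continuousOn_iff_continuous_domRestrict.1 hb).Icc_extend'
    (fun x => hC _ (projIcc 0 T hT x).2)
  refine hcont.continuousOn.congr fun t ht => ?_
  simp only
  rw [integral_indicator_comp_sub_eq_vconv ht.1]
  refine vconv_congr_Ioo ht.1 (fun s hs => ?_) fun s hs => ?_
  · rw [indicator_of_mem (show s ∈ Ioc 0 T from ⟨hs.1, hs.2.le.trans ht.2⟩)]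
  · rw [IccExtend_of_mem hT _ ⟨hs.1.le, hs.2.le.trans ht.2⟩, domRestrict_apply]

theorem continuousOn_Ici_of_Icc {f : ℝ → ℝ} (h : ∀ T, 0 < T → ContinuousOn f (Icc 0 T)) :
    ContinuousOn f (Ici 0) := by
  intro t ht
  have h1 : 0 < t + 1 := by linarith [mem_Ici.1 ht]
  have := h (t + 1) h1 t ⟨ht, by linarith⟩
  refine this.mono_of_mem_nhdsWithin ?_
  rw [← Ici_inter_Iic]
  exact inter_mem self_mem_nhdsWithin (mem_nhdsWithin_of_mem_nhds (Iic_mem_nhds (by linarith)))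

theorem continuousOn_vconv (ha : ∀ T, 0 < T → IntegrableOn a (Ioc 0 T))
    (hb : ContinuousOn b (Ici 0)) : ContinuousOn (vconv a b) (Ici 0) :=
  continuousOn_Ici_of_Icc fun T hT =>
    continuousOn_vconv_Icc hT.le (ha T hT) (hb.mono Icc_subset_Ici_self)

/-- The primitive of a Volterra convolution. -/
theorem integral_vconv (ht : 0 ≤ t) (ha : IntegrableOn a (Ioc 0 t))
    (hb : IntegrableOn b (Ioc 0 t)) :
    ∫ τ in (0 : ℝ)..t, vconv a b τ = vconv (fun x => ∫ τ in (0 : ℝ)..x, a τ) b t := by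
  -- After the cut-off, the constraint s < τ is encoded in the vanishing of A on (-∞, 0], so Fubini
  -- applies on a product domain.
  set A := (Ioc 0 t).indicator a with hA
  set B := (Ioc 0 t).indicator b with hB
  have hAi : Integrable A := (integrable_indicator_iff measurableSet_Ioc).2 ha
  have hBi : Integrable B := (integrable_indicator_iff measurableSet_Ioc).2 hb
  have hint := hBi.convolution_integrand (ContinuousLinearMap.mul ℝ ℝ) hAi
  simp only [ContinuousLinearMap.mul_apply'] at hint
  have h1 : ∀ τ ∈ Ioc 0 t, vconv a b τ = ∫ s, B s * A (τ - s) := by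
    intro τ hτ
    rw [vconv_eq_setIntegral_Ioo hτ.1.le, ← integral_indicator measurableSet_Ioo]
    refine integral_congr_ae (ae_of_all _ fun s => ?_)
    simp only
    by_cases hs : s ∈ Ioo 0 τ
    · rw [indicator_of_mem hs, hA, hB, indicator_of_mem, indicator_of_mem, mul_comm]
      · exact ⟨by linarith [hs.2], by linarith [hs.1, hτ.2]⟩
      · exact ⟨hs.1, hs.2.le.trans hτ.2⟩
    · rw [indicator_of_notMem hs]
      rcases le_or_gt s 0 with h | h
      · rw [hB, indicator_of_notMem (fun h' => absurd h'.1 (not_lt.2 h)), zero_mul]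
      · have : τ ≤ s := not_lt.1 fun h' => hs ⟨h, h'⟩
        rw [hA, indicator_of_notMem (fun h' => absurd h'.1 (by linarith)), mul_zero]
  rw [intervalIntegral.integral_of_le ht, setIntegral_congr_fun measurableSet_Ioc h1,
    integral_integral_swap (f := fun τ s => B s * A (τ - s))
      (hint.mono_measure (Measure.prod_mono Measure.restrict_le_self le_rfl)),
    vconv, intervalIntegral.integral_of_le ht, ← integral_indicator measurableSet_Ioc]
  refine integral_congr_ae (ae_of_all _ fun s => ?_)
  simp only
  by_cases hs : s ∈ Ioc 0 t
  · rw [indicator_of_mem hs, integral_const_mul, hB, indicator_of_mem hs, mul_comm]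
    congr 1
    rw [← intervalIntegral.integral_of_le ht, intervalIntegral.integral_comp_sub_right,
      intervalIntegral.integral_of_le (by linarith [hs.1, hs.2]),
      intervalIntegral.integral_of_le (by linarith [hs.1, hs.2]), hA,
      setIntegral_indicator measurableSet_Ioc, Ioc_inter_Ioc]
    congr 2
    rw [max_eq_right (by linarith [hs.1]), min_eq_left (by linarith [hs.1])]
  · rw [indicator_of_notMem hs, hB, indicator_of_notMem hs]
    simp

/-- Integration by parts for a Volterra convolution. -/
theorem integral_vconv' (ht : 0 ≤ t) (ha : IntegrableOn a (Ioc 0 t))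
    (hb : IntegrableOn b (Ioc 0 t)) :
    ∫ τ in (0 : ℝ)..t, vconv a b τ = vconv a (fun x => ∫ τ in (0 : ℝ)..x, b τ) t := by
  rw [vconv_comm, ← integral_vconv ht hb ha]
  exact intervalIntegral.integral_congr fun τ _ => vconv_comm

end Vconv

/-! ### Decreasing kernels and the Volterra equation with a Lipschitz nonlinearity -/

/-- A kernel that is positive and nonincreasing on `(0, ∞)` and integrable near `0`. -/
structure IsDecreasingKernel (k : ℝ → ℝ) : Prop where
  pos : ∀ t, 0 < t → 0 < k t
  antitoneOn : AntitoneOn k (Ioi 0)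
  integrableOn : ∀ T, 0 < T → IntegrableOn k (Ioc 0 T)

namespace IsDecreasingKernel

variable {k : ℝ → ℝ} {t T : ℝ}

theorem integrableOn_Ioc (hk : IsDecreasingKernel k) (t : ℝ) : IntegrableOn k (Ioc 0 t) := by
  rcases le_or_gt t 0 with h | h
  · simp [Ioc_eq_empty (not_lt.2 h)]
  · exact hk.integrableOn t h

theorem intervalIntegrable (hk : IsDecreasingKernel k) (ht : 0 ≤ t) :
    IntervalIntegrable k volume 0 t :=
  (intervalIntegrable_iff_integrableOn_Ioc_of_le ht).2 (hk.integrableOn_Ioc t)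

/-- Near 0 the kernel is integrable, and beyond 1 it is at most k 1. This is the dominating function
for the weights with p ≥ 1. -/
theorem integrableOn_exp_mul (hk : IsDecreasingKernel k) :
    IntegrableOn (fun s => Real.exp (-s) * k s) (Ioi 0) := by
  have hmeas : AEStronglyMeasurable (fun s => Real.exp (-s) * k s) (volume.restrict (Ioi 0)) :=
    ((Real.continuous_exp.comp continuous_neg).aestronglyMeasurable).mul
      (aemeasurable_restrict_of_antitoneOn measurableSet_Ioi hk.antitoneOn).aestronglyMeasurable
  rw [← Ioc_union_Ioi_eq_Ioi (zero_le_one (α := ℝ))]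
  refine IntegrableOn.union ?_ ?_
  · refine (hk.integrableOn 1 one_pos).mono'
      (hmeas.mono_measure (Measure.restrict_mono Ioc_subset_Ioi_self le_rfl)) ?_
    filter_upwards [ae_restrict_mem measurableSet_Ioc] with s hs
    rw [norm_mul, Real.norm_of_nonneg (Real.exp_pos _).le, Real.norm_of_nonneg (hk.pos s hs.1).le]
    exact mul_le_of_le_one_left (hk.pos s hs.1).le (Real.exp_le_one_iff.2 (by linarith [hs.1]))
  · refine ((integrableOn_exp_neg_Ioi 1).mul_const (k 1)).mono'
      (hmeas.mono_measure (Measure.restrict_mono (Ioi_subset_Ioi zero_le_one) le_rfl)) ?_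
    filter_upwards [ae_restrict_mem measurableSet_Ioi] with s hs
    have hs0 : 0 < s := one_pos.trans hs
    rw [norm_mul, Real.norm_of_nonneg (Real.exp_pos _).le, Real.norm_of_nonneg (hk.pos s hs0).le]
    exact mul_le_mul_of_nonneg_left (hk.antitoneOn (mem_Ioi.2 one_pos) (mem_Ioi.2 hs0)
      (le_of_lt hs)) (Real.exp_pos _).le

theorem norm_exp_mul_le (hk : IsDecreasingKernel k) {p s : ℝ} (hp : 1 ≤ p) (hs : 0 < s) :
    ‖Real.exp (-(p * s)) * k s‖ ≤ Real.exp (-s) * k s := by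
  rw [norm_mul, Real.norm_of_nonneg (Real.exp_pos _).le, Real.norm_of_nonneg (hk.pos s hs).le]
  refine mul_le_mul_of_nonneg_right (Real.exp_le_exp.2 ?_) (hk.pos s hs).le
  nlinarith

theorem aestronglyMeasurable_exp_mul (hk : IsDecreasingKernel k) (p : ℝ) :
    AEStronglyMeasurable (fun s => Real.exp (-(p * s)) * k s) (volume.restrict (Ioi 0)) :=
  (Continuous.aestronglyMeasurable (by fun_prop)).mul
    (aemeasurable_restrict_of_antitoneOn measurableSet_Ioi hk.antitoneOn).aestronglyMeasurable

/-- Exponential weights make the `L¹` norm of a decreasing kernel arbitrarily small. -/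
theorem exists_weight (hk : IsDecreasingKernel k) {η : ℝ} (hη : 0 < η) :
    ∃ p, 0 < p ∧ IntegrableOn (fun s => Real.exp (-(p * s)) * k s) (Ioi 0) ∧
      ∫ s in Ioi 0, Real.exp (-(p * s)) * k s < η := by
  have hlim : Tendsto (fun p : ℝ => ∫ s in Ioi 0, Real.exp (-(p * s)) * k s) atTop
      (𝓝 (∫ s in Ioi (0 : ℝ), (0 : ℝ))) := by
    refine tendsto_integral_filter_of_dominated_convergence (fun s => Real.exp (-s) * k s)
      ?_ ?_ hk.integrableOn_exp_mul ?_
    · exact Eventually.of_forall hk.aestronglyMeasurable_exp_mul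
    · filter_upwards [eventually_ge_atTop 1] with p hp
      filter_upwards [ae_restrict_mem measurableSet_Ioi] with s hs
      exact hk.norm_exp_mul_le hp hs
    · filter_upwards [ae_restrict_mem measurableSet_Ioi] with s hs
      have h1 : Tendsto (fun p : ℝ => Real.exp (-(p * s))) atTop (𝓝 0) :=
        Real.tendsto_exp_neg_atTop_nhds_zero.comp (tendsto_id.atTop_mul_const hs)
      simpa using h1.mul_const (k s)
  rw [integral_zero] at hlim
  obtain ⟨p, hp, hp1⟩ := ((hlim.eventually (gt_mem_nhds hη)).and (eventually_ge_atTop 1)).exists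
  refine ⟨p, by linarith, hk.integrableOn_exp_mul.mono' (hk.aestronglyMeasurable_exp_mul p) ?_, hp⟩
  filter_upwards [ae_restrict_mem measurableSet_Ioi] with s hs
  exact hk.norm_exp_mul_le hp1 hs

theorem intervalIntegral_exp_mul_le (hk : IsDecreasingKernel k) {p : ℝ}
    (hp : IntegrableOn (fun s => Real.exp (-(p * s)) * k s) (Ioi 0)) (ht : 0 ≤ t) :
    ∫ s in (0 : ℝ)..t, Real.exp (-(p * s)) * k s ≤
      ∫ s in Ioi 0, Real.exp (-(p * s)) * k s := by
  rw [intervalIntegral.integral_of_le ht]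
  refine setIntegral_mono_set hp ?_ Ioc_subset_Ioi_self.eventuallyLE
  filter_upwards [ae_restrict_mem measurableSet_Ioi] with s hs
  exact mul_nonneg (Real.exp_pos _).le (hk.pos s hs).le

theorem vconv_mono (hk : IsDecreasingKernel k) (ht : 0 ≤ t) {f g : ℝ → ℝ}
    (hf : ContinuousOn f (Icc 0 t)) (hg : ContinuousOn g (Icc 0 t))
    (hfg : ∀ s ∈ Icc 0 t, f s ≤ g s) : vconv k f t ≤ vconv k g t := by
  refine intervalIntegral.integral_mono_on_of_le_Ioo ht
    (intervalIntegrable_vconv ht (hk.integrableOn_Ioc t) hf)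
    (intervalIntegrable_vconv ht (hk.integrableOn_Ioc t) hg) fun s hs => ?_
  exact mul_le_mul_of_nonneg_left (hfg s ⟨hs.1.le, hs.2.le⟩) (hk.pos _ (sub_pos.2 hs.2)).le

theorem vconv_nonneg (hk : IsDecreasingKernel k) (ht : 0 ≤ t) {f : ℝ → ℝ}
    (hf : ∀ s ∈ Icc 0 t, 0 ≤ f s) : 0 ≤ vconv k f t := by
  rw [vconv_eq_setIntegral_Ioo ht]
  exact setIntegral_nonneg measurableSet_Ioo fun s hs =>
    mul_nonneg (hk.pos _ (sub_pos.2 hs.2)).le (hf s ⟨hs.1.le, hs.2.le⟩)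

/-- A Gronwall inequality for Volterra convolutions, in the sup norm. The rate `p` depends only on
the kernel and on `L`. -/
theorem exists_gronwall (hk : IsDecreasingKernel k) {L : ℝ} (hL : 0 ≤ L) :
    ∃ p, ∀ (T η : ℝ) (δ : ℝ → ℝ), 0 ≤ η → ContinuousOn δ (Icc 0 T) →
      (∀ t ∈ Icc 0 T, 0 ≤ δ t) → (∀ t ∈ Icc 0 T, δ t ≤ η + L * vconv k δ t) →
      ∀ t ∈ Icc 0 T, δ t ≤ 2 * η * Real.exp (p * t) := by
  -- This smallness makes L times the weighted L¹ norm of k at most 1/2, so the convolution term is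
  -- absorbed at the cost of the factor 2.
  obtain ⟨p, hp0, hpi, hp⟩ := hk.exists_weight (η := 1 / (2 * (L + 1))) (by positivity)
  refine ⟨p, fun T η δ hη hδc hδ0 hδ t ht => ?_⟩
  -- The inequality is tested only at a maximum point r of the weighted function δ(t) exp(-pt).
  obtain ⟨r, hr, hmax⟩ := isCompact_Icc.exists_isMaxOn ⟨t, ht⟩
    (hδc.mul (Continuous.continuousOn (s := Icc 0 T)
      (f := fun t : ℝ => Real.exp (-(p * t))) (by fun_prop)))
  set M := δ r * Real.exp (-(p * r)) with hM
  have hM0 : 0 ≤ M := mul_nonneg (hδ0 r hr) (Real.exp_pos _).le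
  have hle : ∀ s ∈ Icc 0 T, δ s ≤ M * Real.exp (p * s) := fun s hs => by
    have := hmax hs
    simp only [mem_ofPred_eq] at this
    calc δ s = δ s * Real.exp (-(p * s)) * Real.exp (p * s) := by
          rw [mul_assoc, ← Real.exp_add]; simp
      _ ≤ _ := mul_le_mul_of_nonneg_right this (Real.exp_pos _).le
  have hsub : Icc 0 r ⊆ Icc 0 T := Icc_subset_Icc_right hr.2
  have hconv : vconv k δ r ≤ M * Real.exp (p * r) * (1 / (2 * (L + 1))) := by
    calc vconv k δ r ≤ vconv k (fun s => M * Real.exp (p * s)) r :=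
          hk.vconv_mono hr.1 (hδc.mono hsub) (by fun_prop) fun s hs => hle s (hsub hs)
      _ = M * Real.exp (p * r) * ∫ s in (0 : ℝ)..r, Real.exp (-(p * s)) * k s := by
          rw [vconv_comm, vconv, ← intervalIntegral.integral_const_mul]
          refine intervalIntegral.integral_congr fun s _ => ?_
          rw [mul_sub, sub_eq_add_neg, Real.exp_add]
          ring
      _ ≤ _ := mul_le_mul_of_nonneg_left
          ((hk.intervalIntegral_exp_mul_le hpi hr.1).trans hp.le) (by positivity)
  have hMle : M ≤ 2 * η := by
    have h1 : L * (1 / (2 * (L + 1))) ≤ 1 / 2 := by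
      rw [mul_one_div, div_le_div_iff₀ (by positivity) (by norm_num)]
      linarith
    have hexp : Real.exp (-(p * r)) ≤ 1 :=
      Real.exp_le_one_iff.2 (by nlinarith [mul_nonneg hp0.le hr.1])
    have hee : Real.exp (p * r) * Real.exp (-(p * r)) = 1 := by rw [← Real.exp_add]; simp
    have h2 : M ≤ (η + L * (M * Real.exp (p * r) * (1 / (2 * (L + 1))))) * Real.exp (-(p * r)) :=
      mul_le_mul_of_nonneg_right
        ((hδ r hr).trans (by gcongr)) (Real.exp_pos _).le
    have h3 : (η + L * (M * Real.exp (p * r) * (1 / (2 * (L + 1))))) * Real.exp (-(p * r)) =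
        η * Real.exp (-(p * r)) + L * (1 / (2 * (L + 1))) * M := by
      linear_combination L * M * (1 / (2 * (L + 1))) * hee
    have h4 := mul_le_mul_of_nonneg_left hexp hη
    have h5 := mul_le_mul_of_nonneg_right h1 hM0
    linarith
  exact (hle t ht).trans (mul_le_mul_of_nonneg_right hMle (Real.exp_pos _).le)

/-- The Volterra equation with a globally Lipschitz nonlinearity has a global solution. -/
theorem exists_solution (hk : IsDecreasingKernel k) {G : ℝ → ℝ} {L : ℝ}
    (hL : 0 ≤ L) (hG : ∀ x y, |G x - G y| ≤ L * |x - y|) :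
    ∃ ψ : ℝ → ℝ, Continuous ψ ∧ ∀ t, 0 ≤ t → VolterraEqAt k G ψ t := by
  have hGc : Continuous G :=
    (LipschitzWith.of_dist_le' fun x y => by
      simpa only [Real.dist_eq] using hG x y).continuous
  obtain ⟨p, hp0, hpi, hp⟩ := hk.exists_weight (η := 1 / (2 * (L + 1))) (by positivity)
  set κ : ℝ → ℝ := fun s => Real.exp (-(p * s)) * k s with hκ
  have hκ0 : ∀ s ∈ Ioi (0 : ℝ), 0 ≤ κ s := fun s hs =>
    mul_nonneg (Real.exp_pos _).le (hk.pos s hs).le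
  -- The unknown is χ = exp(-pt) ψ, and N is the nonlinearity conjugated by the weight, with the
  -- same Lipschitz constant. The absolute value keeps the bounds valid on the whole line, where the
  -- bounded continuous functions live.
  let N : (ℝ → ℝ) → ℝ → ℝ := fun χ s => Real.exp (-(p * |s|)) * G (Real.exp (p * |s|) * χ s)
  have hNc : ∀ χ : ℝ → ℝ, Continuous χ → Continuous (N χ) := fun χ hχ => by
    simp only [N]; fun_prop
  have hNlip : ∀ (χ χ' : ℝ → ℝ) s, |N χ s - N χ' s| ≤ L * |χ s - χ' s| := fun χ χ' s => by
    simp only [N]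
    rw [← mul_sub, abs_mul, abs_of_pos (Real.exp_pos _)]
    have h1 := mul_le_mul_of_nonneg_left
      (hG (Real.exp (p * |s|) * χ s) (Real.exp (p * |s|) * χ' s)) (Real.exp_pos (-(p * |s|))).le
    rw [← mul_sub, abs_mul, abs_of_pos (Real.exp_pos _)] at h1
    refine h1.trans (le_of_eq ?_)
    have hee : Real.exp (-(p * |s|)) * Real.exp (p * |s|) = 1 := by rw [← Real.exp_add]; simp
    linear_combination L * |χ s - χ' s| * hee
  have hN0 : ∀ s, |N (fun _ => 0) s| ≤ |G 0| := fun s => by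
    simp only [N, mul_zero, abs_mul, abs_of_pos (Real.exp_pos _)]
    exact mul_le_of_le_one_left (abs_nonneg _) (Real.exp_le_one_iff.2 (by
      have := mul_nonneg hp0.le (abs_nonneg s); linarith))
  have hNb : ∀ (χ : BoundedContinuousFunction ℝ ℝ) s, |N χ s| ≤ |G 0| + L * ‖χ‖ := fun χ s => by
    have h1 := hNlip χ (fun _ => 0) s
    have h2 := χ.norm_coe_le_norm s
    rw [Real.norm_eq_abs] at h2
    simp only [sub_zero] at h1
    have h3 := abs_sub_abs_le_abs_sub (N χ s) (N (fun _ => 0) s)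
    have h4 := mul_le_mul_of_nonneg_left h2 hL
    linarith [hN0 s]
  have hint : ∀ (b : ℝ → ℝ) (C : ℝ), Continuous b → (∀ s, |b s| ≤ C) → ∀ t,
      IntegrableOn (fun s => κ s * (Iio t).indicator (fun s => b (t - s)) s) (Ioi 0) ∧
      |∫ s in Ioi 0, κ s * (Iio t).indicator (fun s => b (t - s)) s| ≤
        1 / (2 * (L + 1)) * C := by
    intro b C hb hC t
    have hC0 : 0 ≤ C := (abs_nonneg _).trans (hC 0)
    have hbound : ∀ᵐ s ∂(volume.restrict (Ioi (0 : ℝ))),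
        ‖κ s * (Iio t).indicator (fun s => b (t - s)) s‖ ≤ κ s * C := by
      filter_upwards [ae_restrict_mem measurableSet_Ioi] with s hs
      rw [norm_mul, Real.norm_of_nonneg (hκ0 s hs)]
      refine mul_le_mul_of_nonneg_left ?_ (hκ0 s hs)
      by_cases h : s ∈ Iio t
      · simpa [indicator_of_mem h] using hC _
      · simpa [indicator_of_notMem h] using hC0
    have hm : AEStronglyMeasurable (fun s => κ s * (Iio t).indicator (fun s => b (t - s)) s)
        (volume.restrict (Ioi 0)) :=
      hpi.1.mul (((hb.measurable.comp (measurable_const.sub measurable_id)).indicator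
        measurableSet_Iio).aestronglyMeasurable)
    refine ⟨(hpi.mul_const C).mono' hm hbound, ?_⟩
    rw [← Real.norm_eq_abs]
    refine (norm_integral_le_of_norm_le (hpi.mul_const C) hbound).trans ?_
    rw [integral_mul_const]
    exact mul_le_mul_of_nonneg_right hp.le hC0
  -- The Picard map in the weighted unknown; the choice of p makes it a contraction with ratio 1/2.
  let Φ : BoundedContinuousFunction ℝ ℝ → BoundedContinuousFunction ℝ ℝ := fun χ =>
    BoundedContinuousFunction.ofNormedAddCommGroup
      (fun t => ∫ s in Ioi 0, κ s * (Iio t).indicator (fun s => N χ (t - s)) s)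
      (continuous_integral_indicator_comp_sub hpi (hNc χ χ.continuous) (hNb χ))
      (1 / (2 * (L + 1)) * (|G 0| + L * ‖χ‖))
      (fun t => (hint _ _ (hNc χ χ.continuous) (hNb χ) t).2)
  have hΦ : ContractingWith (1 / 2) Φ := by
    refine ⟨by norm_num, LipschitzWith.of_dist_le_mul fun χ χ' => ?_⟩
    rw [BoundedContinuousFunction.dist_le (by positivity)]
    intro t
    have hsub : ∫ s in Ioi 0, κ s * (Iio t).indicator (fun s => N χ (t - s) - N χ' (t - s)) s =
        Φ χ t - Φ χ' t := by
      simp only [Φ, BoundedContinuousFunction.coe_ofNormedAddCommGroup]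
      rw [← integral_sub (hint _ _ (hNc χ χ.continuous) (hNb χ) t).1
        (hint _ _ (hNc χ' χ'.continuous) (hNb χ') t).1]
      refine integral_congr_ae (ae_of_all _ fun s => ?_)
      by_cases h : s ∈ Iio t
      · simp [indicator_of_mem h, mul_sub]
      · simp [indicator_of_notMem h]
    rw [Real.dist_eq, ← hsub]
    have h1 := (hint (fun s => N χ s - N χ' s) (L * dist χ χ')
      ((hNc χ χ.continuous).sub (hNc χ' χ'.continuous))
      (fun s => (hNlip χ χ' s).trans (mul_le_mul_of_nonneg_left
        (by rw [← Real.dist_eq]; exact BoundedContinuousFunction.dist_coe_le_dist s) hL)) t).2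
    refine h1.trans ?_
    rw [← mul_assoc]
    refine mul_le_mul_of_nonneg_right ?_ dist_nonneg
    rw [one_div_mul_eq_div, div_le_iff₀ (by positivity)]
    push_cast
    linarith
  let χ := hΦ.fixedPoint Φ
  have hχ : ∀ t, 0 ≤ t → χ t = vconv κ (N χ) t := fun t ht => by
    have h1 : Φ χ = χ := hΦ.fixedPoint_isFixedPt
    rw [← integral_indicator_comp_sub_eq_vconv ht]
    exact (DFunLike.congr_fun h1 t).symm
  refine ⟨fun t => Real.exp (p * |t|) * χ t, by fun_prop, fun t ht => ⟨?_, ?_⟩⟩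
  · exact intervalIntegrable_vconv (b := fun s => G (Real.exp (p * |s|) * χ s)) ht
      (hk.integrableOn_Ioc t) (by fun_prop)
  · simp only
    rw [hχ t ht, vconv, ← intervalIntegral.integral_const_mul]
    refine intervalIntegral.integral_congr fun s hs => ?_
    rw [uIcc_of_le ht] at hs
    simp only [hκ, N]
    rw [abs_of_nonneg ht, abs_of_nonneg hs.1]
    have hee : Real.exp (p * t) * Real.exp (-(p * (t - s))) * Real.exp (-(p * s)) = 1 := by
      rw [← Real.exp_add, ← Real.exp_add, ← Real.exp_zero]
      congr 1; ring
    linear_combination k (t - s) * G (Real.exp (p * s) * χ s) * hee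

/-- Continuous solutions of a Volterra equation with a locally Lipschitz nonlinearity are unique. -/
theorem eqOn_of_isContinuousSolution (hk : IsDecreasingKernel k) {G : ℝ → ℝ}
    (hG : ∀ M, ∃ L, 0 ≤ L ∧ ∀ x y, |x| ≤ M → |y| ≤ M → |G x - G y| ≤ L * |x - y|)
    {φ ψ : ℝ → ℝ} (hφ : IsContinuousSolution k G (Icc 0 T) φ)
    (hψ : IsContinuousSolution k G (Icc 0 T) ψ) : EqOn φ ψ (Icc 0 T) := by
  obtain ⟨M₁, hM₁⟩ := isCompact_Icc.exists_bound_of_continuousOn hφ.1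
  obtain ⟨M₂, hM₂⟩ := isCompact_Icc.exists_bound_of_continuousOn hψ.1
  obtain ⟨L, hL, hLip⟩ := hG (max M₁ M₂)
  obtain ⟨p, hp⟩ := hk.exists_gronwall hL
  have hc : ContinuousOn (fun t => |φ t - ψ t|) (Icc 0 T) := (hφ.1.sub hψ.1).abs
  have := hp T 0 (fun t => |φ t - ψ t|) le_rfl hc (fun t _ => abs_nonneg _) ?_
  · intro t ht
    have h1 := this t ht
    simp only [mul_zero, zero_mul] at h1
    exact sub_eq_zero.1 (abs_nonpos_iff.1 h1)
  · intro t ht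
    have hsub : Icc 0 t ⊆ Icc 0 T := Icc_subset_Icc_right ht.2
    have hφi := (hφ.2 t ht).1
    have hψi := (hψ.2 t ht).1
    rw [(hφ.2 t ht).2, (hψ.2 t ht).2, ← intervalIntegral.integral_sub hφi hψi, zero_add, vconv,
      ← intervalIntegral.integral_const_mul, ← Real.norm_eq_abs]
    refine intervalIntegral.norm_integral_le_of_norm_le ht.1 ?_
      ((intervalIntegrable_vconv ht.1 (hk.integrableOn_Ioc t) (hc.mono hsub)).const_mul L)
    -- The value k 0 has no prescribed sign, so the endpoint s = t is discarded.
    have hne : ∀ᵐ s : ℝ, s ≠ t := Measure.ae_ne volume t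
    filter_upwards [hne] with s hst hs
    have hsT : s ∈ Icc 0 T := hsub ⟨hs.1.le, hs.2⟩
    have hkp := hk.pos (t - s) (sub_pos.2 (lt_of_le_of_ne hs.2 hst))
    rw [← mul_sub, norm_mul, Real.norm_of_nonneg hkp.le, Real.norm_eq_abs]
    have h1 := hLip (φ s) (ψ s) ((hM₁ s hsT).trans (le_max_left _ _))
      ((hM₂ s hsT).trans (le_max_right _ _))
    have h2 := mul_le_mul_of_nonneg_left h1 hkp.le
    linarith

end IsDecreasingKernel

/-! ### Uniqueness among locally square integrable solutions -/

section SquareIntegrable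

open scoped ENNReal

/-- A Gronwall inequality for convolutions, in the `L¹` norm. -/
theorem ae_eq_zero_of_le_lintegral_comp_sub {κ f : ℝ → ℝ≥0∞} {T p : ℝ} (hp : 0 ≤ p)
    (hκ : AEMeasurable κ) (hf : AEMeasurable f (volume.restrict (Ioc 0 T)))
    (hlt : ∫⁻ s, ENNReal.ofReal (Real.exp (-(p * s))) * κ s < 1)
    (hfin : ∫⁻ t in Ioc 0 T, f t ≠ ⊤)
    (hle : ∀ᵐ t ∂(volume.restrict (Ioc 0 T)), f t ≤ ∫⁻ s in Ioc 0 T, κ (t - s) * f s) :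
    ∀ᵐ t ∂(volume.restrict (Ioc 0 T)), f t = 0 := by
  set e : ℝ → ℝ≥0∞ := fun s => ENNReal.ofReal (Real.exp (-(p * s))) with he
  have hem : Measurable e := by simp only [he]; fun_prop
  have hepos : ∀ s, 0 < e s := fun s => ENNReal.ofReal_pos.2 (Real.exp_pos _)
  have hemul : ∀ t s, e t = e (t - s) * e s := fun t s => by
    simp only [he]
    rw [← ENNReal.ofReal_mul (Real.exp_pos _).le, ← Real.exp_add]
    congr 2; ring
  set A := ∫⁻ s, e s * κ s with hA
  set I := ∫⁻ t in Ioc 0 T, e t * f t with hI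
  have hκm : AEMeasurable (fun s => e s * κ s) := hem.aemeasurable.mul hκ
  have hfm : AEMeasurable (fun s => e s * f s) (volume.restrict (Ioc 0 T)) :=
    hem.aemeasurable.mul hf
  have hIfin : I ≠ ⊤ := by
    refine ne_top_of_le_ne_top hfin (lintegral_mono_ae ?_)
    filter_upwards [ae_restrict_mem measurableSet_Ioc] with t ht
    refine mul_le_of_le_one_left' (ENNReal.ofReal_le_one.2 (Real.exp_le_one_iff.2 ?_))
    nlinarith [mul_nonneg hp ht.1.le]
  have hsub : AEMeasurable (Function.uncurry fun t s => e (t - s) * κ (t - s) * (e s * f s))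
      (volume.prod (volume.restrict (Ioc 0 T))) := by
    refine AEMeasurable.mul ?_ (hfm.comp_quasiMeasurePreserving Measure.quasiMeasurePreserving_snd)
    exact hκm.comp_quasiMeasurePreserving
      (quasiMeasurePreserving_sub_of_right_invariant volume (volume.restrict (Ioc 0 T)))
  -- Tonelli and translation invariance bound the weighted integral I by A times itself. With A < 1
  -- and I finite this forces I = 0.
  have hmain : I ≤ A * I := by
    calc I ≤ ∫⁻ t in Ioc 0 T, ∫⁻ s in Ioc 0 T, e (t - s) * κ (t - s) * (e s * f s) := by
          refine lintegral_mono_ae ?_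
          filter_upwards [hle] with t ht
          refine (mul_le_mul_right ht (e t)).trans (le_of_eq ?_)
          rw [← lintegral_const_mul' _ _ ENNReal.ofReal_ne_top]
          refine lintegral_congr fun s => ?_
          rw [show ENNReal.ofReal (Real.exp (-(p * t))) = e t from rfl, hemul t s]
          ring
      _ ≤ ∫⁻ t, ∫⁻ s in Ioc 0 T, e (t - s) * κ (t - s) * (e s * f s) :=
          lintegral_mono' Measure.restrict_le_self le_rfl
      _ = ∫⁻ s in Ioc 0 T, ∫⁻ t, e (t - s) * κ (t - s) * (e s * f s) :=
          lintegral_lintegral_swap hsub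
      _ = ∫⁻ s in Ioc 0 T, A * (e s * f s) := by
          refine lintegral_congr fun s => ?_
          rw [lintegral_mul_const'', lintegral_sub_right_eq_self (fun x => e x * κ x) s]
          exact hκm.comp_quasiMeasurePreserving
            (measurePreserving_sub_right volume s).quasiMeasurePreserving
      _ = A * I := lintegral_const_mul'' _ hfm
  have hI0 : I = 0 := by
    by_contra h
    exact absurd hmain (not_le.2 (by
      simpa using ENNReal.mul_lt_mul_left h hIfin hlt))
  filter_upwards [(lintegral_eq_zero_iff' hfm).1 hI0] with t ht
  exact (mul_eq_zero.1 ht).resolve_left (hepos t).ne'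

variable {k : ℝ → ℝ}

/-- Makes the exponential weights of `exists_weight` available for k², the kernel that
Cauchy–Schwarz produces. -/
theorem IsDecreasingKernel.sq (hk : IsDecreasingKernel k) (hk2 : LocallySquareIntegrable k) :
    IsDecreasingKernel fun t => k t ^ 2 where
  pos t ht := pow_pos (hk.pos t ht) 2
  antitoneOn _ hs t ht hst := pow_le_pow_left₀ (hk.pos t ht).le (hk.antitoneOn hs ht hst) 2
  integrableOn T hT := IntegrableOn.mono_set (hk2 T hT).integrable_sq Ioc_subset_Icc_self

/-- Cauchy–Schwarz without roots. -/
theorem lintegral_mul_sq_le {α : Type*} [MeasurableSpace α] {μ : Measure α} {f g : α → ℝ≥0∞}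
    (hf : AEMeasurable f μ) (hg : AEMeasurable g μ) :
    (∫⁻ a, f a * g a ∂μ) ^ 2 ≤ (∫⁻ a, f a ^ 2 ∂μ) * ∫⁻ a, g a ^ 2 ∂μ := by
  have h := ENNReal.lintegral_mul_le_Lp_mul_Lq μ Real.HolderConjugate.two_two hf hg
  have h2 := pow_le_pow_left' h 2
  simp only [Pi.mul_apply, ENNReal.rpow_ofNat] at h2
  refine h2.trans (le_of_eq ?_)
  rw [mul_pow, ← ENNReal.rpow_natCast, ← ENNReal.rpow_natCast, ← ENNReal.rpow_mul,
    ← ENNReal.rpow_mul]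
  norm_num

theorem lintegral_enorm_sq_ne_top {α : Type*} [MeasurableSpace α] {μ : Measure α} {f : α → ℝ}
    (hf : MemLp f 2 μ) : ∫⁻ a, ‖f a‖ₑ ^ 2 ∂μ ≠ ⊤ := by
  have := lintegral_rpow_enorm_lt_top_of_eLpNorm_lt_top two_ne_zero ENNReal.ofNat_ne_top
    hf.eLpNorm_lt_top
  simpa using this.ne

/-- Locally square integrable solutions of a Volterra equation whose nonlinearity has at most
quadratic growth are unique up to null sets. -/
theorem IsDecreasingKernel.ae_eq_of_isLocallySquareIntegrableSolution (hk : IsDecreasingKernel k)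
    (hk2 : LocallySquareIntegrable k) {G : ℝ → ℝ} {A B : ℝ}
    (hG : ∀ x y, |G x - G y| ≤ |A * (x + y) + B| * |x - y|) {φ ψ : ℝ → ℝ}
    (hφ : IsLocallySquareIntegrableSolution k G φ)
    (hψ : IsLocallySquareIntegrableSolution k G ψ) :
    φ =ᵐ[volume.restrict (Ici (0 : ℝ))] ψ := by
  have key : ∀ T : ℝ, 0 < T → ∀ᵐ t ∂(volume.restrict (Ioc 0 T)), φ t = ψ t := by
    intro T hT
    have hres : volume.restrict (Ioc 0 T) ≤ volume.restrict (Icc 0 T) :=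
      Measure.restrict_mono Ioc_subset_Icc_self le_rfl
    have hφT : MemLp φ 2 (volume.restrict (Ioc 0 T)) := (hφ.1 T hT).mono_measure hres
    have hψT : MemLp ψ 2 (volume.restrict (Ioc 0 T)) := (hψ.1 T hT).mono_measure hres
    -- The Lipschitz modulus along the two solutions: square integrable, but possibly unbounded.
    -- Cauchy–Schwarz separates it from k(t - s)(φ - ψ)(s), so that (φ - ψ)²(t) ≤ C ∫ k(t - s)² (φ -
    -- ψ)²(s) ds with C = ∫ m².
    set m : ℝ → ℝ := fun s => A * (φ s + ψ s) + B with hm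
    have hmT : MemLp m 2 (volume.restrict (Ioc 0 T)) :=
      ((hφT.add hψT).const_mul A).add (memLp_const B)
    have hδT : MemLp (fun s => φ s - ψ s) 2 (volume.restrict (Ioc 0 T)) := hφT.sub hψT
    set C := ∫⁻ s in Ioc 0 T, ‖m s‖ₑ ^ 2 with hC
    have hCtop : C ≠ ⊤ := lintegral_enorm_sq_ne_top hmT
    set κ : ℝ → ℝ≥0∞ := (Ioi 0).indicator fun s => C * ‖k s‖ₑ ^ 2 with hκ
    -- Chosen so that C times the weighted integral of k² is below 1.
    obtain ⟨p, hp0, hpi, hp⟩ := (hk.sq hk2).exists_weight (η := 1 / (C.toReal + 1)) (by positivity)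
    have hkm : AEMeasurable k (volume.restrict (Ioi 0)) :=
      aemeasurable_restrict_of_antitoneOn measurableSet_Ioi hk.antitoneOn
    have hκm : AEMeasurable κ :=
      (aemeasurable_indicator_iff measurableSet_Ioi).2 ((hkm.enorm.pow_const 2).const_mul C)
    have hzero := ae_eq_zero_of_le_lintegral_comp_sub (κ := κ)
      (f := fun s => ‖φ s - ψ s‖ₑ ^ 2) (T := T) hp0.le hκm
      (hδT.aestronglyMeasurable.aemeasurable.enorm.pow_const 2) ?_
      (lintegral_enorm_sq_ne_top hδT) ?_
    · filter_upwards [hzero] with t ht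
      exact sub_eq_zero.1 (enorm_eq_zero.1 (pow_eq_zero_iff two_ne_zero |>.1 ht))
    · have h1 : ∫⁻ s, ENNReal.ofReal (Real.exp (-(p * s))) * κ s =
          C * ∫⁻ s in Ioi 0, ENNReal.ofReal (Real.exp (-(p * s)) * k s ^ 2) := by
        rw [← lintegral_const_mul' _ _ hCtop, ← lintegral_indicator measurableSet_Ioi]
        refine lintegral_congr fun s => ?_
        by_cases hs : s ∈ Ioi (0 : ℝ)
        · rw [hκ, indicator_of_mem hs, indicator_of_mem hs,
            ENNReal.ofReal_mul (Real.exp_pos _).le, ENNReal.ofReal_pow (hk.pos s hs).le,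
            Real.enorm_of_nonneg (hk.pos s hs).le]
          ring
        · rw [hκ, indicator_of_notMem hs, indicator_of_notMem hs, mul_zero]
      rw [h1, ← ofReal_integral_eq_lintegral_ofReal hpi
        (ae_of_all _ fun s => mul_nonneg (Real.exp_pos _).le (sq_nonneg _)),
        ← ENNReal.ofReal_toReal hCtop,
        ← ENNReal.ofReal_mul ENNReal.toReal_nonneg, ENNReal.ofReal_lt_one]
      · have h2 := mul_le_mul_of_nonneg_left hp.le (ENNReal.toReal_nonneg (a := C))
        refine h2.trans_lt ?_
        have : 0 ≤ C.toReal := ENNReal.toReal_nonneg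
        rw [mul_one_div, div_lt_one (by positivity)]
        linarith
    · have hr : volume.restrict (Ioc 0 T) ≤ volume.restrict (Ici (0 : ℝ)) :=
        Measure.restrict_mono (fun s hs => hs.1.le) le_rfl
      filter_upwards [ae_mono hr hφ.2, ae_mono hr hψ.2, ae_restrict_mem measurableSet_Ioc]
        with t hφt hψt ht
      have hsubset : Ioc 0 t ⊆ Ioc 0 T := Ioc_subset_Ioc_right ht.2
      have hrt : volume.restrict (Ioc 0 t) ≤ volume.restrict (Ioc 0 T) :=
        Measure.restrict_mono hsubset le_rfl
      have hkt : AEMeasurable (fun s => k (t - s)) (volume.restrict (Ioc 0 t)) :=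
        ((intervalIntegrable_iff_integrableOn_Ioc_of_le ht.1.le).1
          (intervalIntegrable_comp_sub ht.1.le (hk.integrableOn_Ioc t))).aestronglyMeasurable
          |>.aemeasurable
      have hδm : AEMeasurable (fun s => φ s - ψ s) (volume.restrict (Ioc 0 t)) :=
        hδT.aestronglyMeasurable.aemeasurable.mono_measure hrt
      have hmm : AEMeasurable m (volume.restrict (Ioc 0 t)) :=
        hmT.aestronglyMeasurable.aemeasurable.mono_measure hrt
      have h1 : ‖φ t - ψ t‖ₑ ≤
          ∫⁻ s in Ioc 0 t, ‖m s‖ₑ * (‖k (t - s)‖ₑ * ‖φ s - ψ s‖ₑ) := by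
        rw [hφt.2, hψt.2, ← intervalIntegral.integral_sub hφt.1 hψt.1,
          intervalIntegral.integral_of_le ht.1.le]
        refine (enorm_integral_le_lintegral_enorm _).trans (lintegral_mono fun s => ?_)
        have h2 : ‖G (φ s) - G (ψ s)‖ₑ ≤ ‖m s * (φ s - ψ s)‖ₑ :=
          enorm_le_iff_norm_le.2 (by rw [norm_mul]; exact hG _ _)
        rw [← mul_sub, enorm_mul]
        refine (mul_le_mul_right h2 _).trans (le_of_eq ?_)
        rw [enorm_mul]
        ring
      calc ‖φ t - ψ t‖ₑ ^ 2
          ≤ (∫⁻ s in Ioc 0 t, ‖m s‖ₑ * (‖k (t - s)‖ₑ * ‖φ s - ψ s‖ₑ)) ^ 2 :=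
            pow_le_pow_left' h1 2
        _ ≤ (∫⁻ s in Ioc 0 t, ‖m s‖ₑ ^ 2) *
            ∫⁻ s in Ioc 0 t, (‖k (t - s)‖ₑ * ‖φ s - ψ s‖ₑ) ^ 2 :=
            lintegral_mul_sq_le hmm.enorm (hkt.enorm.mul hδm.enorm)
        _ ≤ C * ∫⁻ s in Ioc 0 t, (‖k (t - s)‖ₑ * ‖φ s - ψ s‖ₑ) ^ 2 :=
            mul_le_mul_left (lintegral_mono_set hsubset) _
        _ = ∫⁻ s in Ioc 0 t, κ (t - s) * ‖φ s - ψ s‖ₑ ^ 2 := by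
            rw [← lintegral_const_mul' _ _ hCtop]
            refine lintegral_congr_ae ?_
            have hne : ∀ᵐ s ∂(volume.restrict (Ioc 0 t)), s ≠ t :=
              ae_restrict_of_ae (Measure.ae_ne volume t)
            filter_upwards [ae_restrict_mem measurableSet_Ioc, hne] with s hs hst
            rw [hκ, indicator_of_mem (mem_Ioi.2 (sub_pos.2 (lt_of_le_of_ne hs.2 hst)))]
            ring
        _ ≤ _ := lintegral_mono_set hsubset
  have hall : ∀ᵐ t : ℝ, ∀ n : ℕ, t ∈ Ioc (0 : ℝ) (n + 1) → φ t = ψ t :=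
    ae_all_iff.2 fun n => (ae_restrict_iff' measurableSet_Ioc).1 (key (n + 1) (by positivity))
  refine (ae_restrict_iff' measurableSet_Ici).2 ?_
  filter_upwards [hall, Measure.ae_ne volume (0 : ℝ)] with t ht ht0 ht1
  obtain ⟨n, hn⟩ := exists_nat_ge t
  exact ht n ⟨lt_of_le_of_ne ht1 (Ne.symm ht0), by linarith⟩

end SquareIntegrable

/-! ### Solutions confined by a zero of the nonlinearity -/

namespace IsDecreasingKernel

variable {k : ℝ → ℝ} {t T : ℝ}

/-- By continuity g is positive on some (0, r), which contributes a positive amount; the rest of the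
integral is nonnegative. -/
theorem vconv_pos (hk : IsDecreasingKernel k) (ht : 0 < t) {g : ℝ → ℝ}
    (hg : ContinuousOn g (Icc 0 t)) (hg0 : ∀ s ∈ Icc 0 t, 0 ≤ g s) (hpos : 0 < g 0) :
    0 < vconv k g t := by
  have hnhds : ∀ᶠ s in 𝓝[Icc 0 t] 0, 0 < g s :=
    (hg 0 ⟨le_rfl, ht.le⟩).eventually (lt_mem_nhds hpos)
  rw [Metric.nhdsWithin_basis_ball.eventually_iff] at hnhds
  obtain ⟨d, hd, hdg⟩ := hnhds
  set r := min (d / 2) t with hr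
  have hr0 : 0 < r := lt_min (by positivity) ht
  have hrt : r ≤ t := min_le_right _ _
  have hi := intervalIntegrable_vconv ht.le (hk.integrableOn_Ioc t) hg
  have hi1 : IntervalIntegrable (fun s => k (t - s) * g s) volume 0 r :=
    hi.mono_set (by rw [uIcc_of_le ht.le, uIcc_of_le hr0.le]; exact Icc_subset_Icc_right hrt)
  have hi2 : IntervalIntegrable (fun s => k (t - s) * g s) volume r t :=
    hi.mono_set (by rw [uIcc_of_le ht.le, uIcc_of_le hrt]; exact Icc_subset_Icc_left hr0.le)
  rw [vconv, ← intervalIntegral.integral_add_adjacent_intervals hi1 hi2]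
  refine add_pos_of_pos_of_nonneg ?_ ?_
  · refine intervalIntegral.intervalIntegral_pos_of_pos_on hi1 (fun s hs => ?_) hr0
    refine mul_pos (hk.pos _ (sub_pos.2 (hs.2.trans_le hrt))) (hdg ⟨?_, hs.1.le, ?_⟩)
    · rw [Metric.mem_ball, Real.dist_eq, sub_zero, abs_of_pos hs.1]
      linarith [hs.2, min_le_left (d / 2) t]
    · exact hs.2.le.trans hrt
  · rw [intervalIntegral.integral_of_le hrt, integral_Ioc_eq_integral_Ioo]
    exact setIntegral_nonneg measurableSet_Ioo fun s hs =>
      mul_nonneg (hk.pos _ (sub_pos.2 hs.2)).le (hg0 s ⟨hr0.le.trans hs.1.le, hs.2.le⟩)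

/-- If the nonlinearity vanishes above the level `b`, so that the forcing stops there, then a
solution of the Volterra equation stays below `b`. -/
theorem le_of_forcing_vanishes_above (hk : IsDecreasingKernel k) {v g : ℝ → ℝ} {b : ℝ} (hb : 0 ≤ b)
    (hv : Continuous v) (hg : Continuous g) (hg0 : ∀ s, 0 ≤ g s)
    (hgb : ∀ s, b ≤ v s → g s = 0) (hvg : ∀ t, 0 ≤ t → v t = vconv k g t) (ht : 0 ≤ t) :
    v t ≤ b := by
  by_contra! hlt
  have hcomp : IsCompact (Icc 0 t ∩ {s | v s ≤ b}) :=
    isCompact_Icc.inter_right (isClosed_le hv continuous_const)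
  have hne : (Icc 0 t ∩ {s | v s ≤ b}).Nonempty := by
    refine ⟨0, ⟨le_rfl, ht⟩, ?_⟩
    simpa [hvg 0 le_rfl] using hb
  -- The last time up to t with v ≤ b. The forcing vanishes on (r, t], and since k(t - s) ≤ k(r - s)
  -- this gives v t ≤ v r ≤ b.
  obtain ⟨r, ⟨hr, hrb⟩, hmax⟩ := hcomp.exists_isGreatest hne
  have habove : ∀ s ∈ Ioc r t, g s = 0 := fun s hs => hgb s <| le_of_not_ge fun h =>
    absurd (hmax ⟨⟨hr.1.trans hs.1.le, hs.2⟩, h⟩) (not_le.2 hs.1)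
  have hi := intervalIntegrable_vconv ht (hk.integrableOn_Ioc t) hg.continuousOn
  have hi1 : IntervalIntegrable (fun s => k (t - s) * g s) volume 0 r :=
    hi.mono_set (by rw [uIcc_of_le ht, uIcc_of_le hr.1]; exact Icc_subset_Icc_right hr.2)
  have hi2 : IntervalIntegrable (fun s => k (t - s) * g s) volume r t :=
    hi.mono_set (by rw [uIcc_of_le ht, uIcc_of_le hr.2]; exact Icc_subset_Icc_left hr.1)
  have h1 : v t = ∫ s in (0 : ℝ)..r, k (t - s) * g s := by
    rw [hvg t ht, vconv, ← intervalIntegral.integral_add_adjacent_intervals hi1 hi2]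
    have : ∫ s in r..t, k (t - s) * g s = ∫ _ in r..t, (0 : ℝ) := by
      refine intervalIntegral.integral_congr_ae (ae_of_all _ fun s hs => ?_)
      rw [uIoc_of_le hr.2] at hs
      rw [habove s hs, mul_zero]
    rw [this]
    simp
  have h2 : v t ≤ v r := by
    rw [h1, hvg r hr.1]
    refine intervalIntegral.integral_mono_on_of_le_Ioo hr.1 hi1
      (intervalIntegrable_vconv hr.1 (hk.integrableOn_Ioc r) hg.continuousOn) fun s hs => ?_
    refine mul_le_mul_of_nonneg_right (hk.antitoneOn ?_ ?_ ?_) (hg0 s)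
    · exact mem_Ioi.2 (sub_pos.2 hs.2)
    · exact mem_Ioi.2 (sub_pos.2 (hs.2.trans_le hr.2))
    · linarith [hr.2]
  exact absurd (h2.trans hrb) (not_le.2 hlt)

/-- A Volterra equation whose nonlinearity is nonnegative on `[0, b]` and vanishes at `b` has a
global solution with values in `[0, b]`. -/
theorem exists_solution_mem_Icc (hk : IsDecreasingKernel k) {H : ℝ → ℝ} {b L : ℝ} (hb : 0 < b)
    (hL : 0 ≤ L) (hlip : ∀ x ∈ Icc 0 b, ∀ y ∈ Icc 0 b, |H x - H y| ≤ L * |x - y|)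
    (hnonneg : ∀ x ∈ Icc 0 b, 0 ≤ H x) (hHb : H b = 0) (hH0 : 0 < H 0) :
    ∃ v : ℝ → ℝ, Continuous v ∧ (∀ t, 0 ≤ t → v t ∈ Icc 0 b) ∧
      (∀ t, 0 ≤ t → VolterraEqAt k H v t) ∧ ∀ t, 0 < t → 0 < v t := by
  -- The composite of H with this projection is globally Lipschitz, nonnegative everywhere and zero
  -- above b.
  set P : ℝ → ℝ := fun x => projIcc 0 b hb.le x with hP
  have hPm : ∀ x, P x ∈ Icc 0 b := fun x => (projIcc 0 b hb.le x).2
  have hPeq : ∀ x ∈ Icc 0 b, P x = x := fun x hx => by simp only [hP, projIcc_of_mem hb.le hx]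
  have hlip' : ∀ x y, |H (P x) - H (P y)| ≤ L * |x - y| := fun x y =>
    (hlip _ (hPm x) _ (hPm y)).trans
      (mul_le_mul_of_nonneg_left (abs_projIcc_sub_projIcc hb.le) hL)
  obtain ⟨v, hvc, hv⟩ := hk.exists_solution (G := fun x => H (P x)) hL hlip'
  have hHc : Continuous fun x => H (P x) :=
    (LipschitzWith.of_dist_le' fun x y => by
      simpa only [Real.dist_eq] using hlip' x y).continuous
  have hgc : Continuous fun s => H (P (v s)) := hHc.comp hvc
  have hg0 : ∀ s, 0 ≤ H (P (v s)) := fun s => hnonneg _ (hPm _)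
  have hvg : ∀ t, 0 ≤ t → v t = vconv k (fun s => H (P (v s))) t := fun t ht => (hv t ht).2
  have hmem : ∀ t, 0 ≤ t → v t ∈ Icc 0 b := fun t ht => by
    refine ⟨?_, hk.le_of_forcing_vanishes_above hb.le hvc hgc hg0 (fun s hs => ?_) hvg ht⟩
    · rw [hvg t ht]
      exact hk.vconv_nonneg ht fun s _ => hg0 s
    · simp only [hP, projIcc_of_right_le hb.le hs, hHb]
  have hv0 : v 0 = 0 := by simp [hvg 0 le_rfl]
  refine ⟨v, hvc, hmem, fun t ht => ?_, fun t ht => ?_⟩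
  · have heq : ∀ s ∈ uIcc 0 t, k (t - s) * H (P (v s)) = k (t - s) * H (v s) := fun s hs => by
      rw [uIcc_of_le ht] at hs
      rw [hPeq _ (hmem s hs.1)]
    exact ⟨intervalIntegrable_vconv (b := fun s => H (v s)) ht (hk.integrableOn_Ioc t)
      (hgc.continuousOn.congr fun s hs => by simp only [hPeq _ (hmem s hs.1)]),
      (hv t ht).2.trans (intervalIntegral.integral_congr heq)⟩
  · rw [hvg t ht.le]
    refine hk.vconv_pos ht hgc.continuousOn (fun s _ => hg0 s) ?_
    rw [hv0, hPeq 0 ⟨le_rfl, hb.le⟩]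
    exact hH0

/-- Stability of bounded solutions of a Volterra equation under a decrease of the kernel. -/
theorem exists_stability (hk : IsDecreasingKernel k) {H : ℝ → ℝ} {b L C : ℝ}
    (hL : 0 ≤ L) (hC : 0 ≤ C) (hlip : ∀ x ∈ Icc 0 b, ∀ y ∈ Icc 0 b, |H x - H y| ≤ L * |x - y|)
    (hHC : ∀ x ∈ Icc 0 b, |H x| ≤ C) :
    ∃ p, ∀ (T : ℝ) (k' v v' : ℝ → ℝ), IsDecreasingKernel k' → (∀ s, 0 < s → k' s ≤ k s) →
      ContinuousOn v (Icc 0 T) → ContinuousOn v' (Icc 0 T) →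
      (∀ t ∈ Icc 0 T, v t ∈ Icc 0 b) → (∀ t ∈ Icc 0 T, v' t ∈ Icc 0 b) →
      (∀ t ∈ Icc 0 T, VolterraEqAt k H v t) → (∀ t ∈ Icc 0 T, VolterraEqAt k' H v' t) →
      ∀ t ∈ Icc 0 T, |v t - v' t| ≤
        2 * ((∫ s in (0 : ℝ)..T, (k s - k' s)) * C) * Real.exp (p * t) := by
  obtain ⟨p, hp⟩ := hk.exists_gronwall hL
  refine ⟨p, fun T k' v v' hk' hle hvc hvc' hvm hvm' hv hv' t ht => ?_⟩
  have hT : 0 ≤ T := ht.1.trans ht.2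
  have hdiff : ∀ r, 0 ≤ r → IntervalIntegrable (fun s => k s - k' s) volume 0 r := fun r hr =>
    (hk.intervalIntegrable hr).sub (hk'.intervalIntegrable hr)
  have hnn : 0 ≤ᵐ[volume.restrict (Ioc 0 T)] fun s => k s - k' s := by
    filter_upwards [ae_restrict_mem measurableSet_Ioc] with s hs
    exact sub_nonneg.2 (hle s hs.1)
  have hD : 0 ≤ ∫ s in (0 : ℝ)..T, (k s - k' s) := by
    rw [intervalIntegral.integral_of_le hT]
    exact integral_nonneg_of_ae hnn
  refine hp T _ (fun t => |v t - v' t|) (mul_nonneg hD hC) (hvc.sub hvc').abs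
    (fun t _ => abs_nonneg _) (fun r hr => ?_) t ht
  have hsub : Icc 0 r ⊆ Icc 0 T := Icc_subset_Icc_right hr.2
  have hDr : ∫ s in (0 : ℝ)..r, (k (r - s) - k' (r - s)) ≤ ∫ s in (0 : ℝ)..T, (k s - k' s) := by
    rw [intervalIntegral.integral_comp_sub_left (fun s => k s - k' s), sub_self, sub_zero,
      intervalIntegral.integral_of_le hr.1, intervalIntegral.integral_of_le hT]
    exact setIntegral_mono_set
      ((intervalIntegrable_iff_integrableOn_Ioc_of_le hT).1 (hdiff T hT)) hnn
      (Ioc_subset_Ioc_right hr.2).eventuallyLE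
  have hi1 : IntervalIntegrable (fun s => (k (r - s) - k' (r - s)) * C) volume 0 r :=
    ((intervalIntegrable_comp_sub hr.1 (hk.integrableOn_Ioc r)).sub
      (intervalIntegrable_comp_sub hr.1 (hk'.integrableOn_Ioc r))).mul_const C
  have hi2 : IntervalIntegrable (fun s => L * (k (r - s) * |v s - v' s|)) volume 0 r :=
    (intervalIntegrable_vconv hr.1 (hk.integrableOn_Ioc r)
      (((hvc.sub hvc').abs).mono hsub)).const_mul L
  have hbound : |v r - v' r| ≤
      ∫ s in (0 : ℝ)..r, ((k (r - s) - k' (r - s)) * C + L * (k (r - s) * |v s - v' s|)) := by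
    rw [(hv r hr).2, (hv' r hr).2, ← intervalIntegral.integral_sub (hv r hr).1 (hv' r hr).1,
      ← Real.norm_eq_abs]
    refine intervalIntegral.norm_integral_le_of_norm_le hr.1 ?_ (hi1.add hi2)
    filter_upwards [Measure.ae_ne volume r] with s hsr hs
    have hsT : s ∈ Icc 0 T := hsub ⟨hs.1.le, hs.2⟩
    have hrs : 0 < r - s := sub_pos.2 (lt_of_le_of_ne hs.2 hsr)
    have h1 := hlip _ (hvm s hsT) _ (hvm' s hsT)
    have h2 := hHC _ (hvm' s hsT)
    -- Splitting this way pairs the kernel difference with the bound C on H, and k with the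
    -- Lipschitz estimate that feeds Gronwall.
    rw [show k (r - s) * H (v s) - k' (r - s) * H (v' s) =
      (k (r - s) - k' (r - s)) * H (v' s) + k (r - s) * (H (v s) - H (v' s)) by ring]
    refine (norm_add_le _ _).trans (add_le_add ?_ ?_)
    · rw [norm_mul, Real.norm_of_nonneg (sub_nonneg.2 (hle _ hrs))]
      exact mul_le_mul_of_nonneg_left h2 (sub_nonneg.2 (hle _ hrs))
    · rw [norm_mul, Real.norm_of_nonneg (hk.pos _ hrs).le]
      refine (mul_le_mul_of_nonneg_left h1 (hk.pos _ hrs).le).trans (le_of_eq ?_)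
      ring
  rw [intervalIntegral.integral_add hi1 hi2, intervalIntegral.integral_mul_const,
    intervalIntegral.integral_const_mul] at hbound
  exact hbound.trans (add_le_add (mul_le_mul_of_nonneg_right hDr hC) le_rfl)

end IsDecreasingKernel

/-! ### Monotonicity of solutions for smooth log-convex kernels -/

theorem hasDerivAt_integral_of_continuousOn_Ici {f : ℝ → ℝ} (hf : ContinuousOn f (Ici 0)) {t : ℝ}
    (ht : 0 < t) : HasDerivAt (fun x => ∫ s in (0 : ℝ)..x, f s) (f t) t := by
  refine intervalIntegral.integral_hasDerivAt_right ?_ ?_ ?_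
  · refine ContinuousOn.intervalIntegrable (hf.mono ?_)
    rw [uIcc_of_le ht.le]
    exact Icc_subset_Ici_self
  · exact (hf.mono Ioi_subset_Ici_self).stronglyMeasurableAtFilter isOpen_Ioi t ht
  · exact hf.continuousAt (Ici_mem_nhds ht)

theorem monotoneOn_Icc_of_hasDerivAt_nonneg {f f' : ℝ → ℝ} {T : ℝ} (hc : ContinuousOn f (Icc 0 T))
    (hd : ∀ t ∈ Ioo 0 T, HasDerivAt f (f' t) t) (h0 : ∀ t ∈ Ioo 0 T, 0 ≤ f' t) :
    MonotoneOn f (Icc 0 T) := by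
  refine monotoneOn_of_hasDerivWithinAt_nonneg (f' := f') (convex_Icc 0 T) hc ?_ ?_
  · intro x hx
    rw [interior_Icc] at hx
    exact (hd x hx).hasDerivWithinAt
  · intro x hx
    rw [interior_Icc] at hx
    exact h0 x hx

/-- A positive, nonincreasing, log-convex kernel `k` that is continuously differentiable on
`[0, ∞)` with derivative `k'`. -/
structure IsLogConvexKernel (k k' : ℝ → ℝ) : Prop where
  hasDerivAt : ∀ t, 0 ≤ t → HasDerivAt k (k' t) t
  continuousOn_deriv : ContinuousOn k' (Ici 0)
  pos : ∀ t, 0 ≤ t → 0 < k t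
  deriv_nonpos : ∀ t, 0 ≤ t → k' t ≤ 0
  monotoneOn_logDeriv : MonotoneOn (fun t => k' t / k t) (Ici 0)

/-- A nonlinearity `H` with derivative `H'` that decreases from a positive value at `0` to its first
zero `b`, with slope at most `Λ` in absolute value. -/
structure IsDecreasingToZero (H H' : ℝ → ℝ) (b Λ : ℝ) : Prop where
  zero_lt : 0 < b
  hasDerivAt : ∀ x, HasDerivAt H (H' x) x
  continuous_deriv : Continuous H'
  deriv_nonpos : ∀ x ∈ Icc 0 b, H' x ≤ 0
  le_deriv : ∀ x ∈ Icc 0 b, -Λ ≤ H' x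
  eq_zero : H b = 0
  pos : ∀ x ∈ Ico 0 b, 0 < H x

namespace IsDecreasingToZero

variable {H H' : ℝ → ℝ} {b Λ : ℝ}

theorem continuous (hH : IsDecreasingToZero H H' b Λ) : Continuous H :=
  continuous_iff_continuousAt.2 fun x => (hH.hasDerivAt x).continuousAt

theorem antitoneOn (hH : IsDecreasingToZero H H' b Λ) : AntitoneOn H (Icc 0 b) :=
  antitoneOn_of_hasDerivWithinAt_nonpos (convex_Icc 0 b) hH.continuous.continuousOn
    (fun x _ => (hH.hasDerivAt x).hasDerivWithinAt)
    fun x hx => hH.deriv_nonpos x (interior_subset hx)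

theorem nonneg (hH : IsDecreasingToZero H H' b Λ) {x : ℝ} (hx : x ∈ Icc 0 b) : 0 ≤ H x := by
  rw [← hH.eq_zero]
  exact hH.antitoneOn hx ⟨hH.zero_lt.le, le_rfl⟩ hx.2

theorem nonneg_slope (hH : IsDecreasingToZero H H' b Λ) : 0 ≤ Λ := by
  have h0 : (0 : ℝ) ∈ Icc 0 b := ⟨le_rfl, hH.zero_lt.le⟩
  linarith [hH.deriv_nonpos 0 h0, hH.le_deriv 0 h0]

theorem lipschitz (hH : IsDecreasingToZero H H' b Λ) {x y : ℝ} (hx : x ∈ Icc 0 b)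
    (hy : y ∈ Icc 0 b) : |H x - H y| ≤ Λ * |x - y| := by
  refine (convex_Icc 0 b).norm_image_sub_le_of_norm_hasDerivWithin_le (f' := H')
    (fun z _ => (hH.hasDerivAt z).hasDerivWithinAt) (fun z hz => ?_) hy hx
  rw [Real.norm_eq_abs, abs_of_nonpos (hH.deriv_nonpos z hz)]
  linarith [hH.le_deriv z hz]

/-- At most linear vanishing at b is what keeps solutions strictly below b in finite time and makes
∫ du / H(u) diverge there. -/
theorem le_mul_sub (hH : IsDecreasingToZero H H' b Λ) {x : ℝ} (hx : x ∈ Icc 0 b) :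
    H x ≤ Λ * (b - x) := by
  have := hH.lipschitz hx ⟨hH.zero_lt.le, le_rfl⟩
  rw [hH.eq_zero, sub_zero, abs_of_nonneg (hH.nonneg hx), abs_of_nonpos (by linarith [hx.2])]
    at this
  linarith

theorem hasDerivAt_integral_inv (hH : IsDecreasingToZero H H' b Λ) {x : ℝ} (hx : x ∈ Ico 0 b) :
    HasDerivAt (fun w => ∫ u in (0 : ℝ)..w, 1 / H u) (1 / H x) x := by
  refine intervalIntegral.integral_hasDerivAt_right ?_ ?_ ?_
  · refine ContinuousOn.intervalIntegrable fun u hu => ?_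
    rw [uIcc_of_le hx.1] at hu
    exact (continuousAt_const.div hH.continuous.continuousAt
      (hH.pos u ⟨hu.1, hu.2.trans_lt hx.2⟩).ne').continuousWithinAt
  · exact (measurable_const.div hH.continuous.measurable).stronglyMeasurable
      |>.stronglyMeasurableAtFilter
  · exact continuousAt_const.div hH.continuous.continuousAt (hH.pos x hx).ne'

end IsDecreasingToZero

namespace IsLogConvexKernel

variable {k k' g : ℝ → ℝ} {t T : ℝ}

theorem continuousOn (hk : IsLogConvexKernel k k') : ContinuousOn k (Ici 0) := fun t ht =>
  (hk.hasDerivAt t ht).continuousAt.continuousWithinAt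

theorem integrableOn_Ioc (hk : IsLogConvexKernel k k') (T : ℝ) : IntegrableOn k (Ioc 0 T) :=
  ((hk.continuousOn.mono Icc_subset_Ici_self).integrableOn_Icc (b := T)).mono_set
    Ioc_subset_Icc_self

theorem integrableOn_deriv_Ioc (hk : IsLogConvexKernel k k') (T : ℝ) :
    IntegrableOn k' (Ioc 0 T) :=
  ((hk.continuousOn_deriv.mono Icc_subset_Ici_self).integrableOn_Icc (b := T)).mono_set
    Ioc_subset_Icc_self

theorem integral_deriv (hk : IsLogConvexKernel k k') (ht : 0 ≤ t) :
    ∫ s in (0 : ℝ)..t, k' s = k t - k 0 := by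
  refine intervalIntegral.integral_eq_sub_of_hasDerivAt (fun s hs => ?_)
    ((intervalIntegrable_iff_integrableOn_Ioc_of_le ht).2 (hk.integrableOn_deriv_Ioc t))
  rw [uIcc_of_le ht] at hs
  exact hk.hasDerivAt s hs.1

/-- The derivative of `vconv k g`. -/
noncomputable def vconvDeriv (k k' g : ℝ → ℝ) (t : ℝ) : ℝ := k 0 * g t + vconv k' g t

theorem continuousOn_vconvDeriv (hk : IsLogConvexKernel k k') (hg : ContinuousOn g (Ici 0)) :
    ContinuousOn (vconvDeriv k k' g) (Ici 0) :=
  (continuousOn_const.mul hg).add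
    (continuousOn_vconv (fun T _ => hk.integrableOn_deriv_Ioc T) hg)

/-- Write k(t - s) = k(0) + ∫₀^{t-s} k' and apply Fubini. The derivative falls on k, so g need only
be continuous. -/
theorem vconv_eq_integral (hk : IsLogConvexKernel k k') (hg : ContinuousOn g (Ici 0))
    (ht : 0 ≤ t) : vconv k g t = ∫ s in (0 : ℝ)..t, vconvDeriv k k' g s := by
  have hgt : ContinuousOn g (Icc 0 t) := hg.mono Icc_subset_Ici_self
  have hgi : IntervalIntegrable g volume 0 t :=
    ContinuousOn.intervalIntegrable (by rwa [uIcc_of_le ht])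
  have hci : IntervalIntegrable (vconv k' g) volume 0 t := by
    refine ContinuousOn.intervalIntegrable ?_
    rw [uIcc_of_le ht]
    exact continuousOn_vconv_Icc ht (hk.integrableOn_deriv_Ioc t) hgt
  unfold vconvDeriv
  rw [intervalIntegral.integral_add (hgi.const_mul _) hci, intervalIntegral.integral_const_mul,
    integral_vconv ht (hk.integrableOn_deriv_Ioc t)
      ((intervalIntegrable_iff_integrableOn_Ioc_of_le ht).1 hgi), vconv, vconv,
    ← intervalIntegral.integral_const_mul, ← intervalIntegral.integral_add (hgi.const_mul _)]
  · refine intervalIntegral.integral_congr fun s hs => ?_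
    rw [uIcc_of_le ht] at hs
    rw [hk.integral_deriv (by linarith [hs.2])]
    ring
  · refine ContinuousOn.intervalIntegrable (ContinuousOn.mul (fun s hs => ?_) ?_)
    · rw [uIcc_of_le ht] at hs ⊢
      have h1 : ContinuousOn (fun s => k (t - s) - k 0) (Icc 0 t) :=
        (hk.continuousOn.comp (f := fun s => t - s) (by fun_prop)
          fun s hs => mem_Ici.2 (by linarith [hs.2])).sub continuousOn_const
      refine (h1.congr fun s hs => ?_) s hs
      exact hk.integral_deriv (by linarith [hs.2])
    · rwa [uIcc_of_le ht]

theorem hasDerivAt_vconv (hk : IsLogConvexKernel k k') (hg : ContinuousOn g (Ici 0))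
    (ht : 0 < t) : HasDerivAt (vconv k g) (vconvDeriv k k' g t) t := by
  refine (hasDerivAt_integral_of_continuousOn_Ici (hk.continuousOn_vconvDeriv hg)
    ht).congr_of_eventuallyEq ?_
  filter_upwards [Ioi_mem_nhds ht] with s hs
  exact hk.vconv_eq_integral hg (le_of_lt hs)

section Solution

variable {H H' v : ℝ → ℝ} {b Λ : ℝ}

/-- The derivative of a solution solves a linear Volterra equation. -/
theorem vconvDeriv_eq (hk : IsLogConvexKernel k k') (hH : IsDecreasingToZero H H' b Λ)
    (hvc : ContinuousOn v (Ici 0)) (hv : ∀ t, 0 ≤ t → v t = vconv k (fun s => H (v s)) t)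
    (ht : 0 ≤ t) :
    vconvDeriv k k' (fun s => H (v s)) t = H 0 * k t -
      vconv k (fun s => -H' (v s) * vconvDeriv k k' (fun s => H (v s)) s) t := by
  set g : ℝ → ℝ := fun s => H (v s) with hg
  set w := vconvDeriv k k' g with hw
  -- Since v' = w, the forcing g = H(v) has derivative -q, so g = H 0 - ∫ q. Substituting in v = k *
  -- g and integrating by parts writes v as the primitive of H 0 · k - k * q, whose integrand must
  -- be w.
  set q : ℝ → ℝ := fun s => -H' (v s) * w s with hq
  have hgc : ContinuousOn g (Ici 0) := hH.continuous.comp_continuousOn hvc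
  have hwc : ContinuousOn w (Ici 0) := hk.continuousOn_vconvDeriv hgc
  have hqc : ContinuousOn q (Ici 0) := (hH.continuous_deriv.comp_continuousOn hvc).neg.mul hwc
  have hv0 : v 0 = 0 := by simp [hv 0 le_rfl]
  have hg0 : g 0 = H 0 := by simp [hg, hv0]
  have hvd : ∀ t, 0 < t → HasDerivAt v (w t) t := fun t ht => by
    refine (hk.hasDerivAt_vconv hgc ht).congr_of_eventuallyEq ?_
    filter_upwards [Ioi_mem_nhds ht] with s hs
    exact hv s (le_of_lt hs)
  have hgq : ∀ t, 0 ≤ t → g t = H 0 - ∫ s in (0 : ℝ)..t, q s := fun t ht => by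
    have h1 := intervalIntegral.integral_eq_sub_of_hasDerivAt_of_le ht
      (hgc.mono Icc_subset_Ici_self) (f' := fun s => -q s) (fun s hs => by
        simp only [hq, neg_mul, neg_neg]
        exact (hH.hasDerivAt (v s)).comp s (hvd s hs.1))
      (ContinuousOn.intervalIntegrable (by
        rw [uIcc_of_le ht]; exact (hqc.mono Icc_subset_Ici_self).neg))
    rw [intervalIntegral.integral_neg] at h1
    linarith
  rcases ht.eq_or_lt with rfl | ht
  · simp [hw, vconvDeriv, hg0, mul_comm]
  have hqi : ∀ t, IntegrableOn q (Ioc 0 t) := fun t =>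
    ((hqc.mono Icc_subset_Ici_self).integrableOn_Icc (b := t)).mono_set Ioc_subset_Icc_self
  have hrc : ContinuousOn (fun t => H 0 * k t - vconv k q t) (Ici 0) :=
    (continuousOn_const.mul hk.continuousOn).sub
      (continuousOn_vconv (fun T _ => hk.integrableOn_Ioc T) hqc)
  have hvint : ∀ t, 0 ≤ t → v t = ∫ s in (0 : ℝ)..t, (H 0 * k s - vconv k q s) := fun t ht => by
    have hki := (intervalIntegrable_iff_integrableOn_Ioc_of_le ht).2 (hk.integrableOn_Ioc t)
    have hprim : ContinuousOn (fun s => ∫ x in (0 : ℝ)..s, q x) (Icc 0 t) := by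
      refine ((continuousOn_const (c := H 0)).sub (hgc.mono Icc_subset_Ici_self)).congr
        fun s hs => ?_
      simp only [Pi.sub_apply]
      rw [hgq s hs.1]
      ring
    rw [intervalIntegral.integral_sub (hki.const_mul _), intervalIntegral.integral_const_mul,
      integral_vconv' ht (hk.integrableOn_Ioc t) (hqi t), hv t ht, vconv]
    · have h2 : ∫ s in (0 : ℝ)..t, k (t - s) = ∫ s in (0 : ℝ)..t, k s := by
        rw [intervalIntegral.integral_comp_sub_left, sub_self, sub_zero]
      rw [← h2, vconv, ← intervalIntegral.integral_const_mul, ← intervalIntegral.integral_sub]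
      · refine intervalIntegral.integral_congr fun s hs => ?_
        rw [uIcc_of_le ht] at hs
        rw [hgq s hs.1]
        ring
      · exact (intervalIntegrable_comp_sub ht (hk.integrableOn_Ioc t)).const_mul _
      · exact intervalIntegrable_vconv ht (hk.integrableOn_Ioc t) hprim
    · refine ContinuousOn.intervalIntegrable ?_
      rw [uIcc_of_le ht]
      exact (continuousOn_vconv (fun T _ => hk.integrableOn_Ioc T) hqc).mono Icc_subset_Ici_self
  refine (hvd t ht).unique
    ((hasDerivAt_integral_of_continuousOn_Ici hrc ht).congr_of_eventuallyEq ?_)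
  filter_upwards [Ioi_mem_nhds ht] with s hs
  exact hvint s (le_of_lt hs)

/-- The comparison at the heart of Kaluza's argument for log-convex sequences. -/
theorem mul_vconv_deriv_le (hk : IsLogConvexKernel k k') {q : ℝ → ℝ} (ht : 0 ≤ t)
    (hqc : ContinuousOn q (Icc 0 t)) (hq : ∀ s ∈ Icc 0 t, 0 ≤ q s) :
    k t * vconv k' q t ≤ k' t * vconv k q t := by
  rw [vconv, vconv, ← intervalIntegral.integral_const_mul, ← intervalIntegral.integral_const_mul]
  refine intervalIntegral.integral_mono_on ht
    ((intervalIntegrable_vconv ht (hk.integrableOn_deriv_Ioc t) hqc).const_mul _)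
    ((intervalIntegrable_vconv ht (hk.integrableOn_Ioc t) hqc).const_mul _) fun s hs => ?_
  have hts : 0 ≤ t - s := by linarith [hs.2]
  have h1 := hk.monotoneOn_logDeriv (mem_Ici.2 hts) (mem_Ici.2 ht) (by linarith [hs.1])
  rw [div_le_div_iff₀ (hk.pos _ hts) (hk.pos t ht)] at h1
  have := mul_le_mul_of_nonneg_right h1 (hq s hs)
  linarith

/-- For a log-convex kernel and a decreasing nonlinearity, solutions are increasing. -/
theorem vconvDeriv_pos (hk : IsLogConvexKernel k k') (hH : IsDecreasingToZero H H' b Λ)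
    (hvc : ContinuousOn v (Ici 0)) (hvm : ∀ t, 0 ≤ t → v t ∈ Icc 0 b)
    (hv : ∀ t, 0 ≤ t → v t = vconv k (fun s => H (v s)) t) (ht : 0 ≤ t) :
    0 < vconvDeriv k k' (fun s => H (v s)) t := by
  set g : ℝ → ℝ := fun s => H (v s) with hg
  set w := vconvDeriv k k' g with hw
  set q : ℝ → ℝ := fun s => -H' (v s) * w s with hq
  have hgc : ContinuousOn g (Ici 0) := hH.continuous.comp_continuousOn hvc
  have hwc : ContinuousOn w (Ici 0) := hk.continuousOn_vconvDeriv hgc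
  have hqc : ContinuousOn q (Ici 0) := (hH.continuous_deriv.comp_continuousOn hvc).neg.mul hwc
  have hweq : ∀ t, 0 ≤ t → w t = H 0 * k t - vconv k q t := fun t ht =>
    hk.vconvDeriv_eq hH hvc hv ht
  have hk0 := hk.pos 0 le_rfl
  have hw0 : 0 < w 0 := by
    rw [hweq 0 le_rfl, vconv_zero_right_endpoint, sub_zero]
    exact mul_pos (hH.pos 0 ⟨le_rfl, hH.zero_lt⟩) hk0
  by_contra! hle
  have hcomp : IsCompact (Icc 0 t ∩ {s | w s ≤ 0}) := by
    refine isCompact_Icc.of_isClosed_subset ?_ inter_subset_left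
    exact (hwc.mono Icc_subset_Ici_self).preimage_isClosed_of_isClosed isClosed_Icc isClosed_Iic
  -- The first time at which w = v' fails to be positive; before r, q is nonnegative.
  obtain ⟨r, ⟨hr, hrw⟩, hmin⟩ := hcomp.exists_isLeast ⟨t, ⟨ht, le_rfl⟩, hle⟩
  have hr0 : 0 < r := lt_of_le_of_ne hr.1 fun h => absurd hrw (by
    simpa [← h] using hw0)
  have hwpos : ∀ s ∈ Ico 0 r, 0 < w s := fun s hs => lt_of_not_ge fun h =>
    absurd (hmin ⟨⟨hs.1, hs.2.le.trans hr.2⟩, h⟩) (not_le.2 hs.2)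
  -- In (w/k)' the H 0 terms cancel, Kaluza's comparison gives the remaining convolutions a good
  -- sign, and what is left is -k(0) q/k ≥ -k(0) Λ w/k. The exponential factor absorbs this, so w/k
  -- cannot fall to 0 at r.
  have hmono := monotoneOn_Icc_of_hasDerivAt_nonneg (T := r)
    (f := fun s => w s / k s * Real.exp (k 0 * Λ * s))
    (f' := fun s => ((H 0 * k' s - (k 0 * q s + vconv k' q s)) * k s - w s * k' s) / k s ^ 2 *
      Real.exp (k 0 * Λ * s) + w s / k s * (Real.exp (k 0 * Λ * s) * (k 0 * Λ * 1)))
    ?_ ?_ ?_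
  · have h1 := hmono ⟨le_rfl, hr0.le⟩ ⟨hr0.le, le_rfl⟩ hr0.le
    simp only [mul_zero, Real.exp_zero, mul_one] at h1
    have h2 : w r / k r * Real.exp (k 0 * Λ * r) ≤ 0 :=
      mul_nonpos_of_nonpos_of_nonneg (div_nonpos_of_nonpos_of_nonneg hrw (hk.pos r hr0.le).le)
        (Real.exp_pos _).le
    linarith [div_pos hw0 hk0]
  · refine ((hwc.div hk.continuousOn fun s hs => (hk.pos s hs).ne').mul ?_).mono
      Icc_subset_Ici_self
    fun_prop
  · intro s hs
    have hwd : HasDerivAt w (H 0 * k' s - (k 0 * q s + vconv k' q s)) s := by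
      refine (((hk.hasDerivAt s hs.1.le).const_mul (H 0)).sub
        (hk.hasDerivAt_vconv hqc hs.1)).congr_of_eventuallyEq ?_
      filter_upwards [Ioi_mem_nhds hs.1] with x hx
      exact hweq x (le_of_lt hx)
    exact (hwd.div (hk.hasDerivAt s hs.1.le) (hk.pos s hs.1.le).ne').mul
      ((hasDerivAt_id' s).const_mul (k 0 * Λ)).exp
  · intro s hs
    have hks := hk.pos s hs.1.le
    have hq0 : ∀ x ∈ Icc 0 s, 0 ≤ q x := fun x hx =>
      mul_nonneg (neg_nonneg.2 (hH.deriv_nonpos _ (hvm x hx.1)))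
        (hwpos x ⟨hx.1, hx.2.trans_lt hs.2⟩).le
    have h1 := hk.mul_vconv_deriv_le hs.1.le (hqc.mono Icc_subset_Ici_self) hq0
    have h2 : q s ≤ Λ * w s :=
      mul_le_mul_of_nonneg_right (by linarith [hH.le_deriv _ (hvm s hs.1.le)])
        (hwpos s ⟨hs.1.le, hs.2⟩).le
    have h3 : 0 ≤ k 0 * k s * (Λ * w s - q s) :=
      mul_nonneg (mul_pos hk0 hks).le (sub_nonneg.2 h2)
    have h4 : ((H 0 * k' s - (k 0 * q s + vconv k' q s)) * k s - w s * k' s) / k s ^ 2 *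
        Real.exp (k 0 * Λ * s) + w s / k s * (Real.exp (k 0 * Λ * s) * (k 0 * Λ * 1)) =
        (k 0 * k s * (Λ * w s - q s) + (k' s * vconv k q s - k s * vconv k' q s)) / k s ^ 2 *
          Real.exp (k 0 * Λ * s) := by
      have := hweq s hs.1.le
      field_simp
      rw [this]
      ring
    rw [h4]
    exact mul_nonneg (div_nonneg (by linarith) (sq_nonneg _)) (Real.exp_pos _).le

/-- The differential inequality `v' ≤ k H(v)`. -/
theorem vconvDeriv_le (hk : IsLogConvexKernel k k') (hH : IsDecreasingToZero H H' b Λ)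
    (hvc : ContinuousOn v (Ici 0)) (hvm : ∀ t, 0 ≤ t → v t ∈ Icc 0 b)
    (hv : ∀ t, 0 ≤ t → v t = vconv k (fun s => H (v s)) t) (ht : 0 ≤ t) :
    vconvDeriv k k' (fun s => H (v s)) t ≤ k t * H (v t) := by
  have hgc : ContinuousOn (fun s => H (v s)) (Ici 0) := hH.continuous.comp_continuousOn hvc
  have hmono : MonotoneOn v (Icc 0 t) := by
    refine monotoneOn_Icc_of_hasDerivAt_nonneg (hvc.mono Icc_subset_Ici_self) (fun s hs => ?_)
      fun s hs => (hk.vconvDeriv_pos hH hvc hvm hv hs.1.le).le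
    refine (hk.hasDerivAt_vconv hgc hs.1).congr_of_eventuallyEq ?_
    filter_upwards [Ioi_mem_nhds hs.1] with x hx
    exact hv x (le_of_lt hx)
  -- As v increases, H (v s) ≥ H (v t), and k' ≤ 0 reverses the inequality. The resulting term -k(0)
  -- H(v t) cancels the local term of the derivative.
  have h1 : vconv k' (fun s => H (v s)) t ≤ vconv k' (fun _ => H (v t)) t := by
    refine intervalIntegral.integral_mono_on ht
      (intervalIntegrable_vconv ht (hk.integrableOn_deriv_Ioc t) (hgc.mono Icc_subset_Ici_self))
      (intervalIntegrable_vconv ht (hk.integrableOn_deriv_Ioc t) continuousOn_const)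
      fun s hs => ?_
    exact mul_le_mul_of_nonpos_left (hH.antitoneOn (hvm s hs.1) (hvm t ht)
      (hmono hs ⟨ht, le_rfl⟩ hs.2)) (hk.deriv_nonpos _ (by linarith [hs.2]))
  have h2 : vconv k' (fun _ => H (v t)) t = (k t - k 0) * H (v t) := by
    rw [vconv, intervalIntegral.integral_mul_const, intervalIntegral.integral_comp_sub_left,
      sub_self, sub_zero, hk.integral_deriv ht]
  rw [vconvDeriv]
  linarith

/-- A solution is dominated, in the clock `∫ du / H(u)`, by the primitive of the kernel. -/
theorem lt_and_integral_inv_le (hk : IsLogConvexKernel k k') (hH : IsDecreasingToZero H H' b Λ)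
    (hvc : ContinuousOn v (Ici 0)) (hvm : ∀ t, 0 ≤ t → v t ∈ Icc 0 b)
    (hv : ∀ t, 0 ≤ t → v t = vconv k (fun s => H (v s)) t) (ht : 0 ≤ t) :
    v t < b ∧ ∫ u in (0 : ℝ)..v t, 1 / H u ≤ ∫ s in (0 : ℝ)..t, k s := by
  have hgc : ContinuousOn (fun s => H (v s)) (Ici 0) := hH.continuous.comp_continuousOn hvc
  have hv0 : v 0 = 0 := by simp [hv 0 le_rfl]
  have hvd : ∀ t, 0 < t → HasDerivAt v (vconvDeriv k k' (fun s => H (v s)) t) t := fun t ht => by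
    refine (hk.hasDerivAt_vconv hgc ht).congr_of_eventuallyEq ?_
    filter_upwards [Ioi_mem_nhds ht] with s hs
    exact hv s (le_of_lt hs)
  have hle : ∀ t, 0 ≤ t → vconvDeriv k k' (fun s => H (v s)) t ≤ k t * H (v t) :=
    fun t ht => hk.vconvDeriv_le hH hvc hvm hv ht
  have hKd : ∀ t, 0 < t → HasDerivAt (fun x => ∫ s in (0 : ℝ)..x, k s) (k t) t :=
    fun t ht => hasDerivAt_integral_of_continuousOn_Ici hk.continuousOn ht
  have hKc : ∀ T, 0 ≤ T → ContinuousOn (fun x => ∫ s in (0 : ℝ)..x, k s) (Icc 0 T) :=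
    fun T hT => by
      have := intervalIntegral.continuousOn_primitive_interval' (μ := volume)
        ((intervalIntegrable_iff_integrableOn_Ioc_of_le hT).2 (hk.integrableOn_Ioc T))
        (left_mem_uIcc)
      rwa [uIcc_of_le hT] at this
  -- From v' ≤ k H(v) ≤ Λ k (b - v), the product (b - v) exp(Λ ∫ k) is nondecreasing, and it starts
  -- at b > 0.
  have hlt : ∀ t, 0 ≤ t → v t < b := fun t ht => by
    have hmono := monotoneOn_Icc_of_hasDerivAt_nonneg (T := t)
      (f := fun s => (b - v s) * Real.exp (Λ * ∫ x in (0 : ℝ)..s, k x))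
      (((continuousOn_const.sub (hvc.mono Icc_subset_Ici_self))).mul
        ((continuousOn_const.mul (hKc t ht)).rexp))
      (fun s hs => ((hvd s hs.1).const_sub b).mul ((hKd s hs.1).const_mul Λ).exp) ?_
    · have h1 := hmono ⟨le_rfl, ht⟩ ⟨ht, le_rfl⟩ ht
      simp only [hv0, sub_zero, intervalIntegral.integral_same, mul_zero, Real.exp_zero,
        mul_one] at h1
      have h2 := (mul_pos_iff_of_pos_right (Real.exp_pos _)).1 (hH.zero_lt.trans_le h1)
      linarith
    · intro s hs
      have h1 := hle s hs.1.le
      have h2 := mul_le_mul_of_nonneg_left (hH.le_mul_sub (hvm s hs.1.le)) (hk.pos s hs.1.le).le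
      have h3 : 0 ≤ (k s * (Λ * (b - v s)) - vconvDeriv k k' (fun s => H (v s)) s) *
          Real.exp (Λ * ∫ x in (0 : ℝ)..s, k x) :=
        mul_nonneg (by linarith) (Real.exp_pos _).le
      refine h3.trans (le_of_eq ?_)
      ring
  have hQd : ∀ s, 0 ≤ s → HasDerivAt (fun w => ∫ u in (0 : ℝ)..w, 1 / H u) (1 / H (v s)) (v s) :=
    fun s hs => hH.hasDerivAt_integral_inv ⟨(hvm s hs).1, hlt s hs⟩
  refine ⟨hlt t ht, ?_⟩
  have hmono := monotoneOn_Icc_of_hasDerivAt_nonneg (T := t)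
    (f := fun s => (∫ x in (0 : ℝ)..s, k x) - ∫ u in (0 : ℝ)..v s, 1 / H u)
    ((hKc t ht).sub fun s hs =>
      (hQd s hs.1).continuousAt.comp_continuousWithinAt (hvc.mono Icc_subset_Ici_self s hs))
    (fun s hs => (hKd s hs.1).sub ((hQd s hs.1.le).comp s (hvd s hs.1))) ?_
  · have h1 := hmono ⟨le_rfl, ht⟩ ⟨ht, le_rfl⟩ ht
    simp only [hv0, intervalIntegral.integral_same, sub_zero] at h1
    linarith
  · intro s hs
    have hpos := hH.pos (v s) ⟨(hvm s hs.1.le).1, hlt s hs.1.le⟩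
    rw [sub_nonneg, one_div_mul_eq_div, div_le_iff₀ hpos]
    exact hle s hs.1.le

end Solution

end IsLogConvexKernel

/-! ### The time change `∫ du / H(u)` -/

namespace IsDecreasingToZero

variable {H H' : ℝ → ℝ} {b Λ : ℝ}

theorem strictMonoOn_integral_inv (hH : IsDecreasingToZero H H' b Λ) :
    StrictMonoOn (fun w => ∫ u in (0 : ℝ)..w, 1 / H u) (Ico 0 b) := by
  refine strictMonoOn_of_deriv_pos (convex_Ico 0 b)
    (fun x hx => (hH.hasDerivAt_integral_inv hx).continuousAt.continuousWithinAt) fun x hx => ?_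
  have hx' := interior_subset hx
  rw [(hH.hasDerivAt_integral_inv hx').deriv]
  exact one_div_pos.2 (hH.pos x hx')

/-- The time change diverges at the zero `b`, hence is a bijection onto `[0, ∞)`. -/
theorem bijOn_integral_inv (hH : IsDecreasingToZero H H' b Λ) :
    BijOn (fun w => ∫ u in (0 : ℝ)..w, 1 / H u) (Ico 0 b) (Ici 0) := by
  have hb := hH.zero_lt
  have h0 : (0 : ℝ) ∈ Ico 0 b := ⟨le_rfl, hb⟩
  have hmono := hH.strictMonoOn_integral_inv
  have hΛ : 0 < Λ := by
    have h1 := hH.pos 0 h0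
    have h2 := hH.le_mul_sub (x := 0) ⟨le_rfl, hb.le⟩
    rw [sub_zero] at h2
    exact (mul_pos_iff_of_pos_right hb).1 (h1.trans_le h2)
  refine ⟨fun w hw => ?_, hmono.injOn, fun y hy => ?_⟩
  · have := hmono.monotoneOn h0 hw hw.1
    simpa using this
  -- This w solves log(b / (b - w)) / Λ = y. Because H ≤ Λ (b - ·), the time change at w is at least
  -- y, and the intermediate value theorem applies on [0, w].
  · set w := b * (1 - Real.exp (-(Λ * y))) with hw
    have he : Real.exp (-(Λ * y)) ≤ 1 :=
      Real.exp_le_one_iff.2 (by linarith [mul_nonneg hΛ.le (mem_Ici.1 hy)])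
    have hw0 : 0 ≤ w := mul_nonneg hb.le (by linarith)
    have hwb : b - w = b * Real.exp (-(Λ * y)) := by rw [hw]; ring
    have hwlt : w < b := by
      have := mul_pos hb (Real.exp_pos (-(Λ * y)))
      linarith
    have hlt : ∀ s ∈ Icc 0 w, 0 < b - s := fun s hs => by linarith [hs.2]
    have hcQ : ContinuousOn (fun w => ∫ u in (0 : ℝ)..w, 1 / H u) (Icc 0 w) := fun s hs =>
      (hH.hasDerivAt_integral_inv ⟨hs.1, hs.2.trans_lt hwlt⟩).continuousAt.continuousWithinAt
    have hlog := monotoneOn_Icc_of_hasDerivAt_nonneg (T := w)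
      (f := fun s => (∫ u in (0 : ℝ)..s, 1 / H u) + Real.log (b - s) / Λ)
      (f' := fun s => 1 / H s + -1 / (b - s) / Λ)
      (hcQ.add (((continuousOn_const.sub continuousOn_id).log
        fun s hs => (hlt s hs).ne').div_const Λ))
      (fun s hs => (hH.hasDerivAt_integral_inv ⟨hs.1.le, hs.2.trans hwlt⟩).add
        ((((hasDerivAt_id' s).const_sub b).log (hlt s ⟨hs.1.le, hs.2.le⟩).ne').div_const Λ))
      (fun s hs => by
        have h1 := hlt s ⟨hs.1.le, hs.2.le⟩
        have h2 := hH.pos s ⟨hs.1.le, hs.2.trans hwlt⟩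
        have h3 := hH.le_mul_sub (x := s) ⟨hs.1.le, (hs.2.trans hwlt).le⟩
        have h4 := one_div_le_one_div_of_le h2 h3
        have h5 : -1 / (b - s) / Λ = -(1 / (Λ * (b - s))) := by
          field_simp
        rw [h5]
        linarith)
    have hge : y ≤ ∫ u in (0 : ℝ)..w, 1 / H u := by
      have h1 := hlog ⟨le_rfl, hw0⟩ ⟨hw0, le_rfl⟩ hw0
      simp only [intervalIntegral.integral_same, zero_add, sub_zero, hwb] at h1
      rw [Real.log_mul hb.ne' (Real.exp_pos _).ne', Real.log_exp, add_div] at h1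
      have h2 : -(Λ * y) / Λ = -y := by field_simp
      rw [h2] at h1
      linarith
    obtain ⟨x, hx, hxy⟩ := intermediate_value_Icc hw0 hcQ
      (show y ∈ Icc _ _ from ⟨by simpa using hy, hge⟩)
    exact ⟨x, ⟨hx.1, hx.2.trans_lt hwlt⟩, hxy⟩

end IsDecreasingToZero

/-! ### Kernels satisfying the standing assumption -/

namespace KernelAssumption

variable {K : ℝ → ℝ} {ε t : ℝ}

theorem antitoneOn (hK : KernelAssumption K) : AntitoneOn K (Ioi 0) := by
  refine antitoneOn_of_hasDerivAt_nonpos (f' := iteratedDeriv 1 K) (fun t ht => ?_) fun t ht => ?_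
  · simpa using hK.completelyMonotone.hasDerivAt_iteratedDeriv 0 ht
  · simpa using hK.completelyMonotone.2 1 t ht

theorem isDecreasingKernel (hK : KernelAssumption K) : IsDecreasingKernel K where
  pos := hK.pos
  antitoneOn := hK.antitoneOn
  integrableOn T hT := by
    have : IntegrableOn K (Icc 0 T) := (hK.locallySquareIntegrable T hT).integrable one_le_two
    exact this.mono_set Ioc_subset_Icc_self

/-- The shift removes the possible singularity at 0, and K'² ≤ K K'' says that K'/K is
nondecreasing. -/
theorem isLogConvexKernel_shift (hK : KernelAssumption K) (hε : 0 < ε) :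
    IsLogConvexKernel (fun t => K (t + ε)) (fun t => iteratedDeriv 1 K (t + ε)) := by
  have hd0 : ∀ t, 0 < t → HasDerivAt K (iteratedDeriv 1 K t) t := fun t ht => by
    simpa using hK.completelyMonotone.hasDerivAt_iteratedDeriv 0 ht
  have hd1 : ∀ t, 0 < t → HasDerivAt (iteratedDeriv 1 K) (iteratedDeriv 2 K t) t := fun t ht =>
    hK.completelyMonotone.hasDerivAt_iteratedDeriv 1 ht
  have hpos : ∀ t, 0 ≤ t → 0 < t + ε := fun t ht => by linarith
  refine ⟨fun t ht => (hd0 _ (hpos t ht)).comp_add_const t ε, fun t ht => ?_,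
    fun t ht => hK.pos _ (hpos t ht), fun t ht => ?_, ?_⟩
  · exact ((hd1 _ (hpos t ht)).comp_add_const t ε).continuousAt.continuousWithinAt
  · simpa using hK.completelyMonotone.2 1 _ (hpos t ht)
  · have hmono : AntitoneOn (fun t => -(iteratedDeriv 1 K t / K t)) (Ioi 0) := by
      refine antitoneOn_of_hasDerivAt_nonpos
        (fun t ht => ((hd1 t ht).div (hd0 t ht) (hK.pos t ht).ne').neg) fun t ht => ?_
      have := hK.completelyMonotone.sq_deriv_le ht
      refine neg_nonpos.2 (div_nonneg ?_ (sq_nonneg _))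
      linarith
    intro s hs t ht hst
    have := hmono (mem_Ioi.2 (hpos s hs)) (mem_Ioi.2 (hpos t ht)) (by linarith)
    simp only at this ⊢
    linarith

theorem isDecreasingKernel_shift (hK : KernelAssumption K) (hε : 0 < ε) :
    IsDecreasingKernel fun t => K (t + ε) where
  pos t ht := hK.pos _ (by linarith)
  antitoneOn s hs t ht hst := hK.antitoneOn (mem_Ioi.2 (by linarith [mem_Ioi.1 hs]))
    (mem_Ioi.2 (by linarith [mem_Ioi.1 ht])) (by linarith)
  integrableOn T _ := (hK.isLogConvexKernel_shift hε).integrableOn_Ioc T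

theorem shift_le (hK : KernelAssumption K) (hε : 0 < ε) (ht : 0 < t) : K (t + ε) ≤ K t :=
  hK.antitoneOn (mem_Ioi.2 ht) (mem_Ioi.2 (by linarith)) (by linarith)

/-- The difference telescopes to ∫₀^ε K minus the integral of K over [t, t + ε], which is
nonnegative. The bound does not depend on t. -/
theorem integral_sub_shift_le (hK : KernelAssumption K) (hε : 0 < ε) (ht : 0 ≤ t) :
    ∫ s in (0 : ℝ)..t, (K s - K (s + ε)) ≤ ∫ s in (0 : ℝ)..ε, K s := by
  have hk := hK.isDecreasingKernel
  have htε : 0 ≤ t + ε := by linarith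
  have hi := hk.intervalIntegrable htε
  have hi1 : IntervalIntegrable K volume t (t + ε) := hi.mono_set (by
    rw [uIcc_of_le htε, uIcc_of_le (by linarith)]; exact Icc_subset_Icc_left ht)
  have hi2 : IntervalIntegrable K volume ε (t + ε) := hi.mono_set (by
    rw [uIcc_of_le htε, uIcc_of_le (by linarith)]; exact Icc_subset_Icc_left hε.le)
  rw [intervalIntegral.integral_sub (hk.intervalIntegrable ht)
    ((hK.isDecreasingKernel_shift hε).intervalIntegrable ht),
    intervalIntegral.integral_comp_add_right K ε, zero_add]
  have h1 := intervalIntegral.integral_add_adjacent_intervals (hk.intervalIntegrable ht) hi1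
  have h2 := intervalIntegral.integral_add_adjacent_intervals (hk.intervalIntegrable hε.le) hi2
  have h3 : 0 ≤ ∫ s in t..t + ε, K s := by
    rw [intervalIntegral.integral_of_le (by linarith)]
    exact setIntegral_nonneg measurableSet_Ioc fun s hs => (hK.pos s (ht.trans_lt hs.1)).le
  linarith

theorem tendsto_integral_zero (hK : KernelAssumption K) :
    Tendsto (fun ε => ∫ s in (0 : ℝ)..ε, K s) (𝓝[>] 0) (𝓝 0) := by
  have h1 := intervalIntegral.continuousOn_primitive_interval' (μ := volume)
    (hK.isDecreasingKernel.intervalIntegrable zero_le_one) left_mem_uIcc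
  rw [uIcc_of_le zero_le_one] at h1
  have h2 := h1 0 ⟨le_rfl, zero_le_one⟩
  rw [ContinuousWithinAt, intervalIntegral.integral_same] at h2
  refine h2.mono_left (nhdsWithin_le_iff.2 ?_)
  filter_upwards [Ioo_mem_nhdsGT (zero_lt_one (α := ℝ))] with s hs using ⟨hs.1.le, hs.2.le⟩

/-- The bound of a solution by the time change, for a singular kernel. -/
theorem le_of_integral_inv_eq (hK : KernelAssumption K) {H H' v : ℝ → ℝ} {b Λ r : ℝ}
    (hH : IsDecreasingToZero H H' b Λ) (hvc : ContinuousOn v (Ici 0))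
    (hvm : ∀ t, 0 ≤ t → v t ∈ Icc 0 b) (hv : ∀ t, 0 ≤ t → VolterraEqAt K H v t) (ht : 0 ≤ t)
    (hr : r ∈ Ico 0 b) (hrt : ∫ u in (0 : ℝ)..r, 1 / H u = ∫ s in (0 : ℝ)..t, K s) : v t ≤ r := by
  have hk := hK.isDecreasingKernel
  have h0 : (0 : ℝ) ∈ Ico 0 b := ⟨le_rfl, hH.zero_lt⟩
  have hH0 := hH.pos 0 h0
  obtain ⟨p, hp⟩ := hk.exists_stability (H := H) (b := b) hH.nonneg_slope hH0.le
    (fun x hx y hy => hH.lipschitz hx hy) (fun x hx => by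
      rw [abs_of_nonneg (hH.nonneg hx)]
      exact hH.antitoneOn ⟨le_rfl, hH.zero_lt.le⟩ hx hx.1)
  -- For the shifted kernel, the solution u satisfies ∫₀^{u t} du / H ≤ ∫₀ᵗ K(s + ε) ds ≤ ∫₀ᵗ K,
  -- hence u t ≤ r. Stability bounds v t - u t by a multiple of ∫₀^ε K.
  have hbound : ∀ ε, 0 < ε →
      v t ≤ r + 2 * ((∫ s in (0 : ℝ)..ε, K s) * H 0) * Real.exp (p * t) := by
    intro ε hε
    have hkε := hK.isDecreasingKernel_shift hε
    obtain ⟨u, huc, hum, hu, -⟩ := hkε.exists_solution_mem_Icc hH.zero_lt hH.nonneg_slope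
      (fun x hx y hy => hH.lipschitz hx hy) (fun x hx => hH.nonneg hx) hH.eq_zero hH0
    have h1 := hp t _ v u hkε (fun s hs => hK.shift_le hε hs) (hvc.mono Icc_subset_Ici_self)
      huc.continuousOn (fun s hs => hvm s hs.1) (fun s hs => hum s hs.1) (fun s hs => hv s hs.1)
      (fun s hs => hu s hs.1) t ⟨ht, le_rfl⟩
    have h2 := (hK.isLogConvexKernel_shift hε).lt_and_integral_inv_le hH huc.continuousOn hum
      (fun s hs => (hu s hs).2) ht
    have h3 : u t ≤ r := by
      refine (hH.strictMonoOn_integral_inv.le_iff_le ⟨(hum t ht).1, h2.1⟩ hr).1 ?_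
      rw [hrt]
      refine h2.2.trans (intervalIntegral.integral_mono_on_of_le_Ioo ht
        (hkε.intervalIntegrable ht) (hk.intervalIntegrable ht) fun s hs => hK.shift_le hε hs.1)
    have h4 : 2 * ((∫ s in (0 : ℝ)..t, (K s - K (s + ε))) * H 0) * Real.exp (p * t) ≤
        2 * ((∫ s in (0 : ℝ)..ε, K s) * H 0) * Real.exp (p * t) := by
      have := hK.integral_sub_shift_le hε ht
      gcongr
    linarith [le_abs_self (v t - u t)]
  have hlim : Tendsto
      (fun ε => r + 2 * ((∫ s in (0 : ℝ)..ε, K s) * H 0) * Real.exp (p * t)) (𝓝[>] 0)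
      (𝓝 (r + 2 * (0 * H 0) * Real.exp (p * t))) :=
    (((hK.tendsto_integral_zero.mul_const _).const_mul 2).mul_const _).const_add r
  simp only [zero_mul, mul_zero, add_zero] at hlim
  exact ge_of_tendsto hlim (by
    filter_upwards [self_mem_nhdsWithin] with ε hε using hbound ε hε)

end KernelAssumption

/-! ### The Riccati nonlinearity -/

/-- Returns from the nonnegative unknown v to ψ: c = -1 for a positive leading coefficient, c = 1/(1
- 2ρ²) for a negative one. -/
theorem VolterraEqAt.const_mul {K G H v : ℝ → ℝ} {t c : ℝ} (h : VolterraEqAt K H v t)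
    (hc : ∀ x, G (c * x) = c * H x) : VolterraEqAt K G (fun s => c * v s) t := by
  have heq : (fun s => K (t - s) * G (c * v s)) = fun s => c * (K (t - s) * H (v s)) := by
    funext s
    rw [hc]
    ring
  refine ⟨?_, ?_⟩
  · simp only [heq]
    exact h.1.const_mul c
  · simp only [heq, intervalIntegral.integral_const_mul]
    rw [h.2]

theorem locallySquareIntegrable_of_continuous {f : ℝ → ℝ} (hf : Continuous f) :
    LocallySquareIntegrable f := fun _ _ =>
  (memLp_two_iff_integrable_sq hf.aestronglyMeasurable).2
    ((hf.pow 2).continuousOn.integrableOn_Icc)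

section Riccati

variable {κ σ θ ρ : ℝ}

theorem abs_riccatiRhs_sub_le (x y : ℝ) :
    |riccatiRhs κ σ θ ρ x - riccatiRhs κ σ θ ρ y| ≤
      |(1 - 2 * ρ ^ 2) * σ ^ 2 / 2 * (x + y) + -lam κ σ θ ρ| * |x - y| := by
  rw [← abs_mul]
  refine le_of_eq (congrArg _ ?_)
  simp only [riccatiRhs]
  ring

theorem exists_riccatiRhs_lipschitz (κ σ θ ρ M : ℝ) : ∃ L, 0 ≤ L ∧ ∀ x y, |x| ≤ M → |y| ≤ M →
    |riccatiRhs κ σ θ ρ x - riccatiRhs κ σ θ ρ y| ≤ L * |x - y| := by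
  refine ⟨|(1 - 2 * ρ ^ 2) * σ ^ 2 / 2| * (|M| + |M|) + |lam κ σ θ ρ|, by positivity,
    fun x y hx hy => ?_⟩
  refine (abs_riccatiRhs_sub_le x y).trans (mul_le_mul_of_nonneg_right ?_ (abs_nonneg _))
  refine (abs_add_le _ _).trans ?_
  rw [abs_mul, abs_neg]
  gcongr
  exact (abs_add_le _ _).trans
    (add_le_add (hx.trans (le_abs_self M)) (hy.trans (le_abs_self M)))

theorem eqOn_Ici_of_isContinuousSolution {K φ ψ : ℝ → ℝ} (hK : IsDecreasingKernel K)
    (hφ : IsContinuousSolution K (riccatiRhs κ σ θ ρ) (Ici 0) φ)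
    (hψ : IsContinuousSolution K (riccatiRhs κ σ θ ρ) (Ici 0) ψ) : EqOn φ ψ (Ici 0) := fun t ht =>
  hK.eqOn_of_isContinuousSolution (T := t) (exists_riccatiRhs_lipschitz κ σ θ ρ)
    ⟨hφ.1.mono Icc_subset_Ici_self, fun s hs => hφ.2 s hs.1⟩
    ⟨hψ.1.mono Icc_subset_Ici_self, fun s hs => hψ.2 s hs.1⟩ ⟨ht, le_rfl⟩

/-- If the leading coefficient is positive, there is a global, negative solution. -/
theorem exists_neg_solution {K : ℝ → ℝ} (hK : IsDecreasingKernel K) (hσ : 0 < σ) (hθ : θ ≠ 0)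
    (h : 0 < 1 - 2 * ρ ^ 2) :
    ∃ ψ : ℝ → ℝ, Continuous ψ ∧ (∀ t, 0 ≤ t → VolterraEqAt K (riccatiRhs κ σ θ ρ) ψ t) ∧
      ∀ t, 0 < t → ψ t < 0 := by
  set a := (1 - 2 * ρ ^ 2) * σ ^ 2 / 2 with ha
  set l := lam κ σ θ ρ with hl
  have ha0 : 0 < a := by positivity
  have hθ2 : 0 < θ ^ 2 := by positivity
  set d := √(l ^ 2 + 4 * a * θ ^ 2) with hd
  have hd2 : d ^ 2 = l ^ 2 + 4 * a * θ ^ 2 := Real.sq_sqrt (by positivity)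
  have hld : l < d := Real.lt_sqrt_of_sq_lt (by nlinarith [mul_pos ha0 hθ2])
  -- The positive root of -a x² - l x + θ², whatever the sign of l.
  set b := (d - l) / (2 * a) with hb
  have hb0 : 0 < b := div_pos (by linarith) (by linarith)
  have hroot : l * b = θ ^ 2 - a * b ^ 2 := by
    rw [hb]
    field_simp
    nlinarith
  have hfac : ∀ x, b * (-a * x ^ 2 - l * x + θ ^ 2) = (b - x) * (θ ^ 2 + a * b * x) := fun x => by
    linear_combination -x * hroot
  obtain ⟨v, hvc, hvm, hv, hvpos⟩ := hK.exists_solution_mem_Icc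
    (H := fun x => -a * x ^ 2 - l * x + θ ^ 2) (L := a * (2 * b) + |l|) hb0 (by positivity)
    (fun x hx y hy => by
      have : (-a * x ^ 2 - l * x + θ ^ 2) - (-a * y ^ 2 - l * y + θ ^ 2) =
        -(a * (x + y) + l) * (x - y) := by ring
      rw [this, abs_mul, abs_neg]
      refine mul_le_mul_of_nonneg_right ((abs_add_le _ _).trans (add_le_add ?_ le_rfl))
        (abs_nonneg _)
      rw [abs_of_nonneg (mul_nonneg ha0.le (add_nonneg hx.1 hy.1))]
      exact mul_le_mul_of_nonneg_left (by linarith [hx.2, hy.2]) ha0.le)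
    (fun x hx => by
      refine nonneg_of_mul_nonneg_right (a := b) ?_ hb0
      rw [hfac]
      exact mul_nonneg (by linarith [hx.2])
        (add_nonneg hθ2.le (mul_nonneg (mul_pos ha0 hb0).le hx.1)))
    (by linarith) (by simpa using hθ2)
  refine ⟨fun t => -1 * v t, by fun_prop, fun t ht => (hv t ht).const_mul fun x => ?_,
    fun t ht => by linarith [hvpos t ht]⟩
  simp only [riccatiRhs]
  ring

/-- The smaller root w̄_* lies to the left of the vertex λ/σ². On [0, w̄_*] the derivative thus
increases from -λ to minus the square root of the discriminant. -/
theorem isDecreasingToZero_quadratic (hσ : 0 < σ) (hθ : θ ≠ 0) (h : 1 - 2 * ρ ^ 2 < 0)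
    (hlam : 0 < lam κ σ θ ρ)
    (hdisc : 0 < lam κ σ θ ρ ^ 2 + 2 * (1 - 2 * ρ ^ 2) * θ ^ 2 * σ ^ 2) :
    IsDecreasingToZero
      (fun u => σ ^ 2 / 2 * u ^ 2 - lam κ σ θ ρ * u - (1 - 2 * ρ ^ 2) * θ ^ 2)
      (fun u => σ ^ 2 * u - lam κ σ θ ρ) (wBar κ σ θ ρ) (lam κ σ θ ρ) := by
  set l := lam κ σ θ ρ with hl
  set c := 1 - 2 * ρ ^ 2 with hc
  set d := √(l ^ 2 + 2 * c * θ ^ 2 * σ ^ 2) with hd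
  have hσ2 : 0 < σ ^ 2 := by positivity
  have hθ2 : 0 < θ ^ 2 := by positivity
  have hd2 : d ^ 2 = l ^ 2 + 2 * c * θ ^ 2 * σ ^ 2 := Real.sq_sqrt hdisc.le
  have hd0 : 0 < d := Real.sqrt_pos.2 hdisc
  have hdl : d < l := by
    refine lt_of_pow_lt_pow_left₀ 2 hlam.le ?_
    have := mul_pos (mul_pos (neg_pos.2 h) hθ2) hσ2
    linarith
  set b := wBar κ σ θ ρ with hb
  have hbd : σ ^ 2 * b = l - d := by
    rw [hb, wBar, mul_div_cancel₀ _ hσ2.ne']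
  have hb0 : 0 < b := (mul_pos_iff_of_pos_left hσ2).1 (by linarith)
  have hroot : σ ^ 2 / 2 * b ^ 2 - l * b - c * θ ^ 2 = 0 := by
    have : 2 * σ ^ 2 * (σ ^ 2 / 2 * b ^ 2 - l * b - c * θ ^ 2) = 0 := by
      linear_combination (σ ^ 2 * b - l - d) * hbd + hd2
    exact (mul_eq_zero.1 this).resolve_left (by positivity)
  refine ⟨hb0, fun x => ?_, by fun_prop, fun x hx => ?_, fun x hx => ?_, hroot, fun x hx => ?_⟩
  · have := (((hasDerivAt_pow 2 x).const_mul (σ ^ 2 / 2)).sub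
      ((hasDerivAt_id' x).const_mul l)).sub_const (c * θ ^ 2)
    refine this.congr_deriv ?_
    norm_num
    ring
  · have := mul_le_mul_of_nonneg_left hx.2 hσ2.le
    linarith
  · have := mul_nonneg hσ2.le hx.1
    linarith
  · have h1 : σ ^ 2 / 2 * x ^ 2 - l * x - c * θ ^ 2 =
        (b - x) * (l - σ ^ 2 / 2 * (x + b)) := by linear_combination hroot
    rw [h1]
    have h2 := mul_lt_mul_of_pos_left hx.2 hσ2
    exact mul_pos (by linarith [hx.2]) (by linarith)

end Riccati

end VolterraHeston

/-! ### The three cases of the theorem -/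

open VolterraHeston in
theorem lemmaA3 (K : ℝ → ℝ) (hK : KernelAssumption K) (κ σ θ ρ : ℝ)
    (hκ : 0 < κ) (hσ : 0 < σ) (hθ : θ ≠ 0) (hρ : ρ ∈ Set.Icc (-1 : ℝ) 1) :
    -- case (1)
    (0 < 1 - 2 * ρ ^ 2 →
      ∃ ψ : ℝ → ℝ,
        IsContinuousSolution K (riccatiRhs κ σ θ ρ) (Set.Ici 0) ψ ∧
        LocallySquareIntegrable ψ ∧
        (∀ φ : ℝ → ℝ, IsContinuousSolution K (riccatiRhs κ σ θ ρ) (Set.Ici 0) φ →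
          Set.EqOn φ ψ (Set.Ici 0)) ∧
        (∀ φ : ℝ → ℝ, IsLocallySquareIntegrableSolution K (riccatiRhs κ σ θ ρ) φ →
          φ =ᵐ[volume.restrict (Set.Ici (0 : ℝ))] ψ) ∧
        ∀ t : ℝ, 0 < t → ψ t < 0) ∧
    -- case (2)
    (1 - 2 * ρ ^ 2 = 0 →
      (∀ w : ℝ, riccatiRhs κ σ θ ρ w = -lam κ σ θ ρ * w - θ ^ 2) ∧
      ∀ T : ℝ, 0 < T →
        ∃ ψ : ℝ → ℝ,
          IsContinuousSolution K (riccatiRhs κ σ θ ρ) (Set.Icc 0 T) ψ ∧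
          ∀ φ : ℝ → ℝ, IsContinuousSolution K (riccatiRhs κ σ θ ρ) (Set.Icc 0 T) φ →
            Set.EqOn φ ψ (Set.Icc 0 T)) ∧
    -- case (3); the first conjunct says that the inverse function in the bound is well defined
    (1 - 2 * ρ ^ 2 < 0 → 0 < lam κ σ θ ρ →
      0 < lam κ σ θ ρ ^ 2 + 2 * (1 - 2 * ρ ^ 2) * θ ^ 2 * σ ^ 2 →
      Set.BijOn (QBar κ σ θ ρ) (Set.Ico 0 (wBar κ σ θ ρ)) (Set.Ici 0) ∧
      ∃ ψ : ℝ → ℝ,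
        IsContinuousSolution K (riccatiRhs κ σ θ ρ) (Set.Ici 0) ψ ∧
        (∀ φ : ℝ → ℝ, IsContinuousSolution K (riccatiRhs κ σ θ ρ) (Set.Ici 0) φ →
          Set.EqOn φ ψ (Set.Ici 0)) ∧
        ∀ t : ℝ, 0 < t →
          wBar κ σ θ ρ / (1 - 2 * ρ ^ 2) < rBar K κ σ θ ρ t / (1 - 2 * ρ ^ 2) ∧
          rBar K κ σ θ ρ t / (1 - 2 * ρ ^ 2) ≤ ψ t ∧
          ψ t < 0) := by
  have hk := hK.isDecreasingKernel
  refine ⟨fun h => ?_, fun h => ?_, fun h hlam hdisc => ?_⟩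
  · obtain ⟨ψ, hc, hψ, hneg⟩ := exists_neg_solution (κ := κ) hk hσ hθ h
    have hsol : IsContinuousSolution K (riccatiRhs κ σ θ ρ) (Set.Ici 0) ψ :=
      ⟨hc.continuousOn, fun t ht => hψ t ht⟩
    have hL2 := locallySquareIntegrable_of_continuous hc
    refine ⟨ψ, hsol, hL2, fun φ hφ => eqOn_Ici_of_isContinuousSolution hk hφ hsol,
      fun φ hφ => ?_, hneg⟩
    exact hk.ae_eq_of_isLocallySquareIntegrableSolution hK.locallySquareIntegrable
      abs_riccatiRhs_sub_le hφ ⟨hL2, (ae_restrict_iff' measurableSet_Ici).2 (ae_of_all _ hψ)⟩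
  · have hlin : ∀ w : ℝ, riccatiRhs κ σ θ ρ w = -lam κ σ θ ρ * w - θ ^ 2 := fun w => by
      rw [riccatiRhs, h]
      ring
    refine ⟨hlin, fun T hT => ?_⟩
    obtain ⟨ψ, hc, hψ⟩ := hk.exists_solution (G := riccatiRhs κ σ θ ρ)
      (abs_nonneg (lam κ σ θ ρ)) fun x y => by
        rw [hlin, hlin, ← abs_mul, ← abs_neg]
        exact le_of_eq (congrArg _ (by ring))
    have hsol : IsContinuousSolution K (riccatiRhs κ σ θ ρ) (Set.Icc 0 T) ψ :=
      ⟨hc.continuousOn, fun t ht => hψ t ht.1⟩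
    exact ⟨ψ, hsol, fun φ hφ =>
      hk.eqOn_of_isContinuousSolution (exists_riccatiRhs_lipschitz κ σ θ ρ) hφ hsol⟩
  · have hH := isDecreasingToZero_quadratic (κ := κ) hσ hθ h hlam hdisc
    have hbij : Set.BijOn (QBar κ σ θ ρ) (Set.Ico 0 (wBar κ σ θ ρ)) (Set.Ici 0) :=
      hH.bijOn_integral_inv
    obtain ⟨v, hvc, hvm, hv, hvpos⟩ := hk.exists_solution_mem_Icc hH.zero_lt hH.nonneg_slope
      (fun x hx y hy => hH.lipschitz hx hy) (fun x hx => hH.nonneg hx) hH.eq_zero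
      (hH.pos 0 ⟨le_rfl, hH.zero_lt⟩)
    -- With c = 1 - 2ρ², the denominator of Q̄₂ is H(x) = c G(x / c), G being the Riccati
    -- nonlinearity. As c < 0, dividing by it reverses the bounds on v.
    have hsol : IsContinuousSolution K (riccatiRhs κ σ θ ρ) (Set.Ici 0)
        (fun t => (1 - 2 * ρ ^ 2)⁻¹ * v t) := by
      refine ⟨(continuous_const.mul hvc).continuousOn, fun t ht => (hv t ht).const_mul fun x => ?_⟩
      have hne := h.ne
      rw [riccatiRhs]
      field_simp
    refine ⟨hbij, _, hsol, fun φ hφ => eqOn_Ici_of_isContinuousSolution hk hφ hsol,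
      fun t ht => ?_⟩
    have hmem : (∫ s in (0 : ℝ)..t, K s) ∈ QBar κ σ θ ρ '' Set.Ico 0 (wBar κ σ θ ρ) := by
      rw [hbij.image_eq, Set.mem_Ici, intervalIntegral.integral_of_le ht.le]
      exact setIntegral_nonneg measurableSet_Ioc fun s hs => (hK.pos s hs.1).le
    have hr : rBar K κ σ θ ρ t ∈ Set.Ico 0 (wBar κ σ θ ρ) := Function.invFunOn_mem hmem
    have hQr : QBar κ σ θ ρ (rBar K κ σ θ ρ t) = ∫ s in (0 : ℝ)..t, K s :=
      Function.invFunOn_eq hmem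
    have hle : v t ≤ rBar K κ σ θ ρ t :=
      hK.le_of_integral_inv_eq hH hvc.continuousOn hvm hv ht.le hr hQr
    refine ⟨div_lt_div_of_neg_of_lt h hr.2, ?_, ?_⟩
    · rw [div_eq_inv_mul]
      exact mul_le_mul_of_nonpos_left hle (inv_nonpos.2 h.le)
    · exact mul_neg_of_neg_of_pos (inv_lt_zero.2 h) (hvpos t ht)
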